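/- Theorem 3 (GKYP lemma for singular fractional order systems). Let $A, E\in\mathbb{R}^{n\times n}$ ($E$ possibly singular), $B\in\mathbb{R}^{n\times m}$, let $\Theta$ be a complex Hermitian matrix of size $n+m$, and let $\Phi,\Psi$ be complex Hermitian $2\times 2$ matrices. Put $$F=\begin{bmatrix}A&B\\E&0\end{bmatrix},\qquad \Lambda(\Phi,\Psi)=\left\{\lambda\in\mathbb{C}:\ \begin{bmatrix}\lambda\\1\end{bmatrix}^*\Phi\begin{bmatrix}\lambda\\1\end{bmatrix}=0,\ \begin{bmatrix}\lambda\\1\end{bmatrix}^*\Psi\begin{bmatrix}\lambda\\1\end{bmatrix}\ge 0\right\},$$ let $\overline\Lambda=\Lambda$ if $\Lambda$ is bounded and $\overline\Lambda=\Lambda\cup\{\infty\}$ otherwise, and let $\Gamma_\lambda=[\,I_n\ \ -\lambda I_n\,]$ for $\lambda\in\mathbb{C}$, $\Gamma_\infty=[\,0\ \ -I_n\,]$. Suppose that $\Lambda(\Phi,\Psi)$ represents curves, that is, it has no interior points and is the union of finitely many (at least one) curves, a curve being an infinite set of points $c(t)\in\mathbb{C}$ depending continuously on a real parameter $t$ with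 $t_0\le t\le t_1$, where $t_0<t_1$ in $\mathbb{R}\cup\{\pm\infty\}$. (In particular, this covers all such $\Lambda$ that lie in the right half plane.) For $\lambda\in\overline\Lambda$ let $S_\lambda$ denote a matrix whose columns form a basis of the null space of $\Gamma_\lambda F$. Then the following are equivalent: (i) $S_\lambda^*\Theta S_\lambda<0$ for all $\lambda\in\overline\Lambda(\Phi,\Psi)$ (for every choice of the basis); (ii) there exist complex Hermitian $n\times n$ matrices $P$ and $Q$ with $Q>0$ and $F^*(\Phi\otimes P+\Psi\otimes Q)F+\Theta<0$. Here $X>0$ ($X<0$) means that $X$ is Hermitian positive (negative) definite. -/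

import Mathlib

open scoped Matrix Kronecker ComplexOrder

namespace GKYP

/-- Negative definiteness of a complex matrix (being Hermitian is included). -/
def NegDef {ι : Type*} (X : Matrix ι ι ℂ) : Prop := (-X).PosDef

/-- The number `[lam; 1]^* Φ [lam; 1]`. -/
def delta (lam : ℂ) (Φ : Matrix (Fin 2) (Fin 2) ℂ) : ℂ :=
  star ![lam, 1] ⬝ᵥ (Φ *ᵥ ![lam, 1])

/-- The set `Λ(Φ, Ψ)`. The order on `ℂ` is the usual partial one: `0 ≤ z` means that `z` is real
and nonnegative; for Hermitian `Ψ` the number `delta lam Ψ` is always real. -/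
def Lam (Φ Ψ : Matrix (Fin 2) (Fin 2) ℂ) : Set ℂ :=
  {lam | delta lam Φ = 0 ∧ 0 ≤ delta lam Ψ}

/-- `Λ` completed by the point at infinity of the extended complex plane if `Λ` is unbounded. -/
def LamBar (Φ Ψ : Matrix (Fin 2) (Fin 2) ℂ) : Set (OnePoint ℂ) :=
  (fun lam : ℂ => (lam : OnePoint ℂ)) '' Lam Φ Ψ ∪
    {z | z = OnePoint.infty ∧ ¬ Bornology.IsBounded (Lam Φ Ψ)}

/-- A curve: an infinite set of points `c t`, depending continuously on the real parameter `t`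
with `t₀ ≤ t ≤ t₁`, where `t₀ < t₁` are real or infinite. -/
def IsCurve (C : Set ℂ) : Prop :=
  C.Infinite ∧ ∃ (t₀ t₁ : EReal) (c : ℝ → ℂ), t₀ < t₁ ∧
    ContinuousOn c {t : ℝ | t₀ ≤ (t : EReal) ∧ (t : EReal) ≤ t₁} ∧
    C = c '' {t : ℝ | t₀ ≤ (t : EReal) ∧ (t : EReal) ≤ t₁}

/-- A set represents curves if it is the union of finitely many (at least one) curves. The set
has to be thin, i.e. without interior points, because a space-filling parameterization would
otherwise turn, for instance, a closed disc into a curve. -/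
def RepresentsCurves (L : Set ℂ) : Prop :=
  interior L = ∅ ∧ ∃ (k : ℕ) (C : Fin k → Set ℂ), 0 < k ∧ (∀ i, IsCurve (C i)) ∧ L = ⋃ i, C i

/-- `Γ_λ = [I  -λ I]` for finite `λ`, and `Γ_∞ = [0  -I]`. -/
def Gam (n : ℕ) (z : OnePoint ℂ) : Matrix (Fin n) (Fin n ⊕ Fin n) ℂ :=
  z.elim (Matrix.fromCols 0 (-1)) (fun lam : ℂ => Matrix.fromCols 1 (-(lam • 1)))

/-- The complex matrix `F = [A B; E 0]`. -/
def FMat {n m : ℕ} (A E : Matrix (Fin n) (Fin n) ℝ) (B : Matrix (Fin n) (Fin m) ℝ) :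
    Matrix (Fin n ⊕ Fin n) (Fin n ⊕ Fin m) ℂ :=
  (Matrix.fromBlocks A B E 0).map (fun x : ℝ => (x : ℂ))

/-- The index `(i, a)` of a Kronecker product with a `2 × 2` matrix on the left, as an index of
the `i`-th of two blocks. -/
def blockIndex (n : ℕ) : Fin 2 × Fin n ≃ Fin n ⊕ Fin n :=
  (finTwoEquiv.prodCongr (Equiv.refl (Fin n))).trans (Equiv.boolProdEquivSum (Fin n))

/-- The Kronecker product `Φ ⊗ P` with rows and columns indexed as those of a `2 × 2` block
matrix. -/
def kron {n : ℕ} (Φ : Matrix (Fin 2) (Fin 2) ℂ) (P : Matrix (Fin n) (Fin n) ℂ) :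
    Matrix (Fin n ⊕ Fin n) (Fin n ⊕ Fin n) ℂ :=
  (Φ ⊗ₖ P).reindex (blockIndex n) (blockIndex n)

theorem kron_eq {n : ℕ} (Φ : Matrix (Fin 2) (Fin 2) ℂ) (P : Matrix (Fin n) (Fin n) ℂ) :
    kron Φ P = Matrix.fromBlocks (Φ 0 0 • P) (Φ 0 1 • P) (Φ 1 0 • P) (Φ 1 1 • P) := by
  ext (i | i) (j | j) <;> rfl

/-- The columns of `S` form a basis of the null space of `M`. -/
def IsNullBasis {ι κ τ : Type*} [Fintype κ] (M : Matrix ι κ ℂ) (S : Matrix κ τ ℂ) : Prop :=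
  LinearIndependent ℂ S.col ∧
    Submodule.span ℂ (Set.range S.col) = LinearMap.ker M.mulVecLin

end GKYP

/-! Write `F` as two block rows `G 0`, `G 1`. A vector `x` lies in the null space of `Γ_z F` exactly
when its image under `F` is a pure tensor `v ⊗ w`, with `v = (λ, 1)` for `z = λ` and `v = (1, 0)`
for `z = ∞`. On such an image `Φ ⊗ P` takes the value `v*Φv · w*Pw`, which is zero along the curve,
and `Ψ ⊗ Q` takes the value `v*Ψv · w*Qw ≥ 0`. Hence (ii) implies (i).

The converse is a duality argument. If the inequality has no solution, Hahn-Banach separates its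
values from the negative definite cone (`exists_dual_of_infeasible`). The separating functional is a
trace against `K Kᴴ ≠ 0`. Varying `P` and `Q` shows that `W i = G i * K` makes the pencil of `Φ`
vanish and that of `Ψ` positive semidefinite, with `tr KᴴΘK ≥ 0`.

The heart is a lossless rank-one decomposition (`exists_unitary_of_pencil`): a unitary `U` turns the
columns of `(W 0, W 1)` into pure tensors `v j ⊗ V j` with `v j*Φ v j = 0` and `v j*Ψ v j ≥ 0`.
Every column of `K U` then lies in a null space belonging to the completed curve, so (i) makes `tr
KᴴΘK` negative, a contradiction.

For the decomposition, two points of `Λ` and empty interior force `det Φ < 0`, so a congruence makes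
`Φ` skew and its condition says that `Y Zᴴ` is Hermitian. What remains of `Ψ` is a real quadratic
form. If it is indefinite, it factors into linear forms and `exists_unitary_of_posSemidef` applies;
if it is positive semidefinite, `exists_unitary_of_isHermitian` suffices. -/

namespace GKYP

open Matrix

/-! ### Simultaneous column decomposition of two matrices. -/

section Decomposition

variable {n r : Type*} [Fintype n] [Fintype r] [DecidableEq n] [DecidableEq r]

theorem exists_unitary_diagonalization {R : Matrix n n ℂ} (hR : R.IsHermitian) :
    ∃ U ∈ unitaryGroup n ℂ, ∃ d : n → ℝ, R = U * diagonal (fun i => (d i : ℂ)) * Uᴴ ∧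
      (R.PosSemidef → ∀ i, 0 ≤ d i) := by
  refine ⟨hR.eigenvectorUnitary, hR.eigenvectorUnitary.2, hR.eigenvalues, ?_,
    fun h => h.eigenvalues_nonneg⟩
  have := hR.spectral_theorem
  rwa [Unitary.conjStarAlgAut_apply] at this

/-- A Hermitian matrix has a Hermitian generalized inverse, positive semidefinite if the matrix
is. -/
theorem exists_generalized_inverse {R : Matrix n n ℂ} (hR : R.IsHermitian) :
    ∃ X : Matrix n n ℂ, X.IsHermitian ∧ R * X * R = R ∧ (R.PosSemidef → X.PosSemidef) := by
  obtain ⟨U, hU, d, hs, hd⟩ := exists_unitary_diagonalization hR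
  have hUU : Uᴴ * U = 1 := mem_unitaryGroup_iff'.1 hU
  refine ⟨U * diagonal (fun i => ((d i)⁻¹ : ℂ)) * Uᴴ, ?_, ?_, ?_⟩
  · apply isHermitian_mul_mul_conjTranspose
    rw [IsHermitian, diagonal_conjTranspose]
    congr 1
    ext i
    simp
  · have : ∀ D₁ D₂ : Matrix n n ℂ, U * D₁ * Uᴴ * (U * D₂ * Uᴴ) = U * (D₁ * D₂) * Uᴴ := by
      intro D₁ D₂
      calc U * D₁ * Uᴴ * (U * D₂ * Uᴴ) = U * D₁ * (Uᴴ * U) * (D₂ * Uᴴ) := by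
            simp only [Matrix.mul_assoc]
        _ = _ := by rw [hUU]; simp only [Matrix.mul_assoc, Matrix.one_mul]
    rw [hs, this, this, diagonal_mul_diagonal, diagonal_mul_diagonal]
    congr 3
    ext i
    by_cases h : (d i : ℂ) = 0
    · simp [h]
    · field_simp
  · intro hp
    apply PosSemidef.mul_mul_conjTranspose_same
    apply PosSemidef.diagonal
    intro i
    have h3 : ((0 : ℝ) : ℂ) ≤ (((d i)⁻¹ : ℝ) : ℂ) :=
      Complex.real_le_real.2 (inv_nonneg.2 (hd hp i))
    simpa using h3

/-- If `Y Zᴴ` is Hermitian and its kernel is contained in that of `Zᴴ`, then `Z = Y S` for a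
Hermitian matrix `S`, which can be diagonalized. -/
theorem exists_unitary_of_ker {Y Z : Matrix n r ℂ} (hR : (Y * Zᴴ).IsHermitian)
    (hker : ∀ M : Matrix n n ℂ, Y * Zᴴ * M = 0 → Zᴴ * M = 0) :
    ∃ U ∈ unitaryGroup r ℂ, ∃ s : r → ℝ, Z * U = Y * U * diagonal (fun j => (s j : ℂ)) ∧
      ((Y * Zᴴ).PosSemidef → ∀ j, 0 ≤ s j) := by
  obtain ⟨X, hX, hRX, hXp⟩ := exists_generalized_inverse hR
  have hS : (Zᴴ * X * Z).IsHermitian := isHermitian_conjTranspose_mul_mul Z hX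
  have h1 : Z * Yᴴ = Y * Zᴴ := by
    have := hR.eq
    rwa [conjTranspose_mul, conjTranspose_conjTranspose] at this
  have h2 : Zᴴ * (X * (Y * Zᴴ) - 1) = 0 := by
    apply hker
    rw [Matrix.mul_sub, ← Matrix.mul_assoc, hRX, Matrix.mul_one, sub_self]
  have h3 : Zᴴ * X * Z * Yᴴ = Zᴴ := by
    rw [Matrix.mul_sub, Matrix.mul_one, sub_eq_zero] at h2
    rw [Matrix.mul_assoc, h1, Matrix.mul_assoc, h2]
  have h4 : Y * (Zᴴ * X * Z) = Z := by
    have := congrArg conjTranspose h3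
    rwa [conjTranspose_mul, hS.eq, conjTranspose_conjTranspose, conjTranspose_conjTranspose] at this
  obtain ⟨U, hU, s, hs, hsp⟩ := exists_unitary_diagonalization hS
  have hUU : Uᴴ * U = 1 := mem_unitaryGroup_iff'.1 hU
  refine ⟨U, hU, s, ?_, fun hp => hsp ((hXp hp).conjTranspose_mul_mul_same Z)⟩
  calc Z * U = Y * (U * diagonal (fun j => (s j : ℂ)) * Uᴴ) * U := by rw [← hs, h4]
    _ = Y * U * diagonal (fun j => (s j : ℂ)) * (Uᴴ * U) := by simp only [Matrix.mul_assoc]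
    _ = _ := by rw [hUU, Matrix.mul_one]

omit [Fintype n] [DecidableEq n] [DecidableEq r] in
-- The perturbation adds a multiple of the Gram matrix `Y Yᴴ + Z Zᴴ`, whose kernel is the common
-- kernel of `Yᴴ` and `Zᴴ`. This is how the kernel hypothesis of `exists_unitary_of_ker` is
-- enforced.
theorem perturbed_mul {Y Z : Matrix n r ℂ} (hR : (Y * Zᴴ).IsHermitian) (ε : ℝ) :
    (Y + (ε : ℂ) • Z) * (Z + (ε : ℂ) • Y)ᴴ
      = (1 + (ε : ℂ) ^ 2) • (Y * Zᴴ) + (ε : ℂ) • (Y * Yᴴ + Z * Zᴴ) := by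
  have h1 : Z * Yᴴ = Y * Zᴴ := by
    have := hR.eq
    rwa [conjTranspose_mul, conjTranspose_conjTranspose] at this
  simp only [conjTranspose_add, conjTranspose_smul, Matrix.mul_add, Matrix.add_mul,
    Matrix.mul_smul, Matrix.smul_mul, h1, RCLike.star_def, Complex.conj_ofReal]
  module

omit [Fintype n] [DecidableEq n] [DecidableEq r] in
theorem isHermitian_perturbed {Y Z : Matrix n r ℂ} (hR : (Y * Zᴴ).IsHermitian) (ε : ℝ) :
    ((Y + (ε : ℂ) • Z) * (Z + (ε : ℂ) • Y)ᴴ).IsHermitian := by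
  rw [perturbed_mul hR]
  have h1 : (Y * Yᴴ)ᴴ = Y * Yᴴ := by simp
  have h2 : (Z * Zᴴ)ᴴ = Z * Zᴴ := by simp
  rw [IsHermitian, conjTranspose_add, conjTranspose_smul, conjTranspose_smul, hR.eq,
    conjTranspose_add, h1, h2]
  simp

omit [DecidableEq n] [DecidableEq r] in
-- The trace is the sum of the squared Frobenius norms of `Yᴴ M` and `Zᴴ M`.
theorem conjTranspose_mul_eq_zero_of_trace {Y Z : Matrix n r ℂ} {M : Matrix n n ℂ}
    (h : (Mᴴ * (Y * Yᴴ + Z * Zᴴ) * M).trace ≤ 0) : Yᴴ * M = 0 ∧ Zᴴ * M = 0 := by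
  have e : Mᴴ * (Y * Yᴴ + Z * Zᴴ) * M = (Yᴴ * M)ᴴ * (Yᴴ * M) + (Zᴴ * M)ᴴ * (Zᴴ * M) := by
    simp only [conjTranspose_mul, conjTranspose_conjTranspose, Matrix.mul_add, Matrix.add_mul,
      Matrix.mul_assoc]
  rw [e, trace_add] at h
  have h1 := (posSemidef_conjTranspose_mul_self (Yᴴ * M)).trace_nonneg
  have h2 := (posSemidef_conjTranspose_mul_self (Zᴴ * M)).trace_nonneg
  constructor
  · rw [← trace_conjTranspose_mul_self_eq_zero_iff]
    exact le_antisymm (le_trans (le_add_of_nonneg_right h2) h) h1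
  · rw [← trace_conjTranspose_mul_self_eq_zero_iff]
    exact le_antisymm (le_trans (le_add_of_nonneg_left h1) h) h2

omit [Fintype r] [DecidableEq n] [DecidableEq r] in
theorem conjTranspose_perturbed_mul_eq_zero {Y Z : Matrix n r ℂ} {M : Matrix n n ℂ}
    (h : Yᴴ * M = 0 ∧ Zᴴ * M = 0) (ε : ℝ) : (Z + (ε : ℂ) • Y)ᴴ * M = 0 := by
  rw [conjTranspose_add, conjTranspose_smul, Matrix.add_mul, Matrix.smul_mul, h.1, h.2]
  simp

/-- If `Y Zᴴ` is Hermitian, then a unitary change of the columns makes each column of `Y`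
and `Z` a pair of real multiples of a common vector. -/
theorem exists_unitary_of_isHermitian {Y Z : Matrix n r ℂ} (hR : (Y * Zᴴ).IsHermitian) :
    ∃ U ∈ unitaryGroup r ℂ, ∃ (V : Matrix n r ℂ) (a b : r → ℝ), (∀ j, a j ≠ 0 ∨ b j ≠ 0) ∧
      Y * U = V * diagonal (fun j => (a j : ℂ)) ∧ Z * U = V * diagonal (fun j => (b j : ℂ)) := by
  set G := Y * Yᴴ + Z * Zᴴ with hG
  have hGp : G.PosSemidef :=
    (posSemidef_self_mul_conjTranspose Y).add (posSemidef_self_mul_conjTranspose Z)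
  obtain ⟨X, hX, hGX, -⟩ := exists_generalized_inverse hGp.1
  -- If the perturbed product kills `M`, then `Y Zᴴ M = -μ G M` with `μ = ε / (1 + ε²)`, so `X G M`
  -- satisfies the eigenvector equation of `X Y Zᴴ` for `-μ`. The spectrum is finite and `ε ↦ μ` is
  -- injective on `(0, 1)`, so some `ε` forces `X G M = 0`.
  obtain ⟨ε, hε0, hε1, hε⟩ : ∃ ε : ℝ, 0 < ε ∧ ε < 1 ∧
      -((ε : ℂ) / (1 + (ε : ℂ) ^ 2)) ∉ spectrum ℂ (X * (Y * Zᴴ)) := by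
    by_contra! hcon
    have hinj : Set.InjOn (fun ε : ℝ => -((ε : ℂ) / (1 + (ε : ℂ) ^ 2))) (Set.Ioo 0 1) := by
      intro x hx y hy hxy
      simp only [neg_inj] at hxy
      have hxy' : x / (1 + x ^ 2) = y / (1 + y ^ 2) := by exact_mod_cast hxy
      rw [div_eq_div_iff (by positivity) (by positivity)] at hxy'
      have h : (x - y) * (1 - x * y) = 0 := by linear_combination hxy'
      rcases mul_eq_zero.1 h with h | h
      · linarith
      · have := mul_lt_one_of_nonneg_of_lt_one_left hx.1.le hx.2 hy.2.le
        linarith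
    have hfin : ((fun ε : ℝ => -((ε : ℂ) / (1 + (ε : ℂ) ^ 2))) '' (Set.Ioo 0 1)).Finite :=
      (Matrix.finite_spectrum (X * (Y * Zᴴ))).subset
        (by rintro _ ⟨e, he, rfl⟩; exact hcon e he.1 he.2)
    exact (Set.Ioo_infinite (zero_lt_one (α := ℝ))) (hfin.of_finite_image hinj)
  have hne : (1 + (ε : ℂ) ^ 2) ≠ 0 := by
    have : (1 + ε ^ 2 : ℝ) ≠ 0 := by positivity
    exact_mod_cast this
  have hker : ∀ M : Matrix n n ℂ, (Y + (ε : ℂ) • Z) * (Z + (ε : ℂ) • Y)ᴴ * M = 0 →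
      (Z + (ε : ℂ) • Y)ᴴ * M = 0 := by
    intro M hM
    rw [perturbed_mul hR, ← hG] at hM
    have hM1 : Y * Zᴴ * M = -((ε : ℂ) / (1 + (ε : ℂ) ^ 2)) • (G * M) := by
      rw [Matrix.add_mul, Matrix.smul_mul, Matrix.smul_mul] at hM
      have := congrArg (fun N => (1 + (ε : ℂ) ^ 2)⁻¹ • N) hM
      simp only [smul_add, smul_smul, inv_mul_cancel₀ hne, one_smul, smul_zero] at this
      rw [eq_neg_of_add_eq_zero_left this, neg_smul, div_eq_inv_mul]
    have key : ∀ N : Matrix n n ℂ, G * N = 0 → Yᴴ * N = 0 ∧ Zᴴ * N = 0 := by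
      intro N hN
      apply conjTranspose_mul_eq_zero_of_trace
      rw [← hG, Matrix.mul_assoc, hN]
      simp
    have hd := key (M - X * G * M) (by
      rw [Matrix.mul_sub, ← Matrix.mul_assoc, ← Matrix.mul_assoc, hGX, sub_self])
    have hM2 : Y * Zᴴ * (X * G * M) = Y * Zᴴ * M := by
      have := hd.2
      rw [Matrix.mul_sub, sub_eq_zero] at this
      rw [Matrix.mul_assoc Y, Matrix.mul_assoc Y, this]
    have hu := hε
    rw [spectrum.notMem_iff] at hu
    have hz : (algebraMap ℂ (Matrix n n ℂ) (-((ε : ℂ) / (1 + (ε : ℂ) ^ 2))) - X * (Y * Zᴴ))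
        * (X * G * M) = 0 := by
      rw [Matrix.sub_mul, Algebra.algebraMap_eq_smul_one, Matrix.smul_mul, Matrix.one_mul,
        Matrix.mul_assoc X (Y * Zᴴ), hM2, hM1, Matrix.mul_smul, ← Matrix.mul_assoc, sub_self]
    have h0 : X * G * M = 0 := by
      exact hu.mul_right_eq_zero.1 hz
    have hM3 : G * M = 0 := by
      calc G * M = G * (X * G * M) := by
            rw [← Matrix.mul_assoc, ← Matrix.mul_assoc, hGX]
        _ = 0 := by rw [h0, Matrix.mul_zero]
    exact conjTranspose_perturbed_mul_eq_zero (key M hM3) ε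
  obtain ⟨U, hU, s, hs, -⟩ := exists_unitary_of_ker (isHermitian_perturbed hR ε) hker
  have hne2 : (1 - (ε : ℂ) ^ 2) ≠ 0 := by
    have : (1 - ε ^ 2 : ℝ) ≠ 0 := by nlinarith
    exact_mod_cast this
  -- These coefficients invert the perturbation `(Y, Z) ↦ (Y + εZ, Z + εY)`, whose determinant is `1
  -- - ε²`.
  refine ⟨U, hU, (1 - (ε : ℂ) ^ 2)⁻¹ • ((Y + (ε : ℂ) • Z) * U), fun j => 1 - ε * s j,
    fun j => s j - ε, ?_, ?_, ?_⟩
  · intro j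
    by_contra! h
    have h1 : s j = ε := by linarith [h.2]
    rw [h1] at h
    nlinarith [h.1]
  all_goals
    ext i j
    have hij := congrFun (congrFun hs i) j
    simp only [mul_diagonal, Matrix.add_mul, Matrix.smul_mul, Matrix.add_apply,
      Matrix.smul_apply, smul_eq_mul, Complex.ofReal_sub, Complex.ofReal_mul,
      Complex.ofReal_one] at hij ⊢
    rw [mul_assoc, eq_inv_mul_iff_mul_eq₀ hne2]
  · linear_combination (-(ε : ℂ)) * hij
  · linear_combination hij

theorem isCompact_unitaryGroup : IsCompact (unitaryGroup r ℂ : Set (Matrix r r ℂ)) := by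
  apply (isCompact_univ_pi fun _ : r => isCompact_univ_pi fun _ : r =>
    isCompact_closedBall (0 : ℂ) 1).of_isClosed_subset
  · have : (unitaryGroup r ℂ : Set (Matrix r r ℂ)) = {U | Uᴴ * U = 1} := by
      ext U
      exact mem_unitaryGroup_iff'
    rw [this]
    exact isClosed_eq (by fun_prop) continuous_const
  · intro U hU i _ j _
    simpa using entry_norm_bound_of_unitary hU i j

/-- If `Y Zᴴ` is positive semidefinite, then a unitary change of the columns makes each column of
`Y` and `Z` a pair of nonnegative multiples of a common vector. -/
theorem exists_unitary_of_posSemidef {Y Z : Matrix n r ℂ} (hR : (Y * Zᴴ).PosSemidef) :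
    ∃ U ∈ unitaryGroup r ℂ, ∃ (V : Matrix n r ℂ) (a b : r → ℝ),
      (∀ j, 0 ≤ a j ∧ 0 ≤ b j ∧ a j + b j = 1) ∧
      Y * U = V * diagonal (fun j => (a j : ℂ)) ∧ Z * U = V * diagonal (fun j => (b j : ℂ)) := by
  -- The slopes `s j ≥ 0` may blow up as `ε → 0`. Recording them as `1 / (1 + s j)` keeps them in
  -- `[0, 1]`, so compactness yields a limit.
  have step : ∀ ε : ℝ, 0 < ε → ∃ p ∈ (unitaryGroup r ℂ : Set (Matrix r r ℂ)) ×ˢ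
      (Set.univ.pi fun _ : r => Set.Icc (0 : ℝ) 1),
      (Z + (ε : ℂ) • Y) * p.1 * diagonal (fun j => (p.2 j : ℂ))
        = (Y + (ε : ℂ) • Z) * p.1 * diagonal (fun j => 1 - (p.2 j : ℂ)) := by
    intro ε hε
    have hεc : (0 : ℂ) < ε := by exact_mod_cast hε
    have hRe : ((Y + (ε : ℂ) • Z) * (Z + (ε : ℂ) • Y)ᴴ).PosSemidef := by
      rw [perturbed_mul hR.1]
      refine (hR.smul ?_).add (((posSemidef_self_mul_conjTranspose Y).add
        (posSemidef_self_mul_conjTranspose Z)).smul hεc.le)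
      have : (0 : ℝ) ≤ 1 + ε ^ 2 := by positivity
      exact_mod_cast this
    have hker : ∀ M : Matrix n n ℂ, (Y + (ε : ℂ) • Z) * (Z + (ε : ℂ) • Y)ᴴ * M = 0 →
        (Z + (ε : ℂ) • Y)ᴴ * M = 0 := by
      intro M hM
      apply conjTranspose_perturbed_mul_eq_zero
      apply conjTranspose_mul_eq_zero_of_trace
      rw [perturbed_mul hR.1] at hM
      have h0 := congrArg (fun N => (Mᴴ * N).trace) hM
      simp only [Matrix.add_mul, Matrix.smul_mul, Matrix.mul_add, Matrix.mul_smul, trace_add,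
        trace_smul, Matrix.mul_zero, trace_zero, smul_eq_mul] at h0
      have h1 := (hR.conjTranspose_mul_mul_same M).trace_nonneg
      have h2 : (0 : ℂ) ≤ 1 + (ε : ℂ) ^ 2 := by
        have : (0 : ℝ) ≤ 1 + ε ^ 2 := by positivity
        exact_mod_cast this
      have h3 : (ε : ℂ) * (Mᴴ * (Y * Yᴴ + Z * Zᴴ) * M).trace ≤ 0 := by
        have h4 := mul_nonneg h2 h1
        have h5 : (ε : ℂ) * (Mᴴ * (Y * Yᴴ + Z * Zᴴ) * M).trace
            = -((1 + (ε : ℂ) ^ 2) * (Mᴴ * (Y * Zᴴ) * M).trace) := by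
          simp only [Matrix.mul_add, Matrix.add_mul, trace_add, Matrix.mul_assoc] at h0 ⊢
          linear_combination h0
        rw [h5]
        exact neg_nonpos.2 h4
      have h6 := mul_nonpos_of_nonneg_of_nonpos (inv_nonneg.2 hεc.le) h3
      rwa [inv_mul_cancel_left₀ hεc.ne'] at h6
    obtain ⟨U, hU, s, hs, hs0⟩ := exists_unitary_of_ker hRe.1 hker
    have hs0 := hs0 hRe
    refine ⟨(U, fun j => (1 + s j)⁻¹), ⟨hU, fun j _ => ⟨?_, ?_⟩⟩, ?_⟩
    · have := hs0 j
      positivity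
    · exact inv_le_one_of_one_le₀ (by linarith [hs0 j])
    · rw [hs, Matrix.mul_assoc _ (diagonal _), diagonal_mul_diagonal]
      congr 2
      ext j
      have : (1 + s j : ℂ) ≠ 0 := by
        have : (1 + s j : ℝ) ≠ 0 := by linarith [hs0 j]
        exact_mod_cast this
      push_cast
      field_simp
      ring
  choose p hpmem hp using fun k : ℕ => step (1 / ((k : ℝ) + 1)) (by positivity)
  have hcomp : IsCompact ((unitaryGroup r ℂ : Set (Matrix r r ℂ)) ×ˢ
      (Set.univ.pi fun _ : r => Set.Icc (0 : ℝ) 1)) :=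
    isCompact_unitaryGroup.prod (isCompact_univ_pi fun _ => isCompact_Icc)
  have : FirstCountableTopology (Matrix r r ℂ) :=
    inferInstanceAs (FirstCountableTopology (r → r → ℂ))
  obtain ⟨q, hq, φ, hφ, hlim⟩ := hcomp.tendsto_subseq hpmem
  have he : Filter.Tendsto (fun k => 1 / (((φ k : ℕ) : ℝ) + 1)) Filter.atTop (nhds 0) :=
    tendsto_one_div_add_atTop_nhds_zero_nat.comp hφ.tendsto_atTop
  have hpair := he.prodMk_nhds hlim
  have hc1 : Continuous (fun x : ℝ × (Matrix r r ℂ × (r → ℝ)) =>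
      (Z + (x.1 : ℂ) • Y) * x.2.1 * diagonal (fun j => (x.2.2 j : ℂ))) := by fun_prop
  have hc2 : Continuous (fun x : ℝ × (Matrix r r ℂ × (r → ℝ)) =>
      (Y + (x.1 : ℂ) • Z) * x.2.1 * diagonal (fun j => 1 - (x.2.2 j : ℂ))) := by fun_prop
  have hfin := tendsto_nhds_unique_of_eventuallyEq ((hc1.tendsto _).comp hpair)
    ((hc2.tendsto _).comp hpair) (Filter.Eventually.of_forall fun k => hp (φ k))
  simp only [Complex.ofReal_zero, zero_smul, add_zero] at hfin
  refine ⟨q.1, hq.1, (Y + Z) * q.1, q.2, fun j => 1 - q.2 j, ?_, ?_, ?_⟩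
  · intro j
    have := hq.2 j (Set.mem_univ j)
    exact ⟨this.1, by linarith [this.2], by ring⟩
  all_goals
    ext i j
    have hij := congrFun (congrFun hfin i) j
    simp only [mul_diagonal, Matrix.add_mul, Matrix.add_apply, Complex.ofReal_sub,
      Complex.ofReal_one] at hij ⊢
  · linear_combination -hij
  · linear_combination hij

end Decomposition

/-! ### Infeasibility of the matrix inequality and its dual. -/

section Separation

variable {n ι : Type*} [Fintype n] [Fintype ι]

/-- The block form `∑ Φ i j • Wⱼ Wᵢᴴ` of the matrix `Φ`. -/
def pencil {r : Type*} [Fintype r] (Φ : Matrix (Fin 2) (Fin 2) ℂ) (W : Fin 2 → Matrix n r ℂ) :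
    Matrix n n ℂ :=
  ∑ i, ∑ j, Φ i j • (W j * (W i)ᴴ)

/-- The matrix `Gᴴ (Φ ⊗ P) G` for a block column `G`. -/
def compression (Φ : Matrix (Fin 2) (Fin 2) ℂ) (P : Matrix n n ℂ) (G : Fin 2 → Matrix n ι ℂ) :
    Matrix ι ι ℂ :=
  ∑ i, ∑ j, Φ i j • ((G i)ᴴ * P * G j)

/-- Cyclicity of the trace: the pencil is the dual object to the compression, with `P` as the free
variable. -/
theorem trace_compression (Φ : Matrix (Fin 2) (Fin 2) ℂ) (P : Matrix n n ℂ)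
    (G : Fin 2 → Matrix n ι ℂ) (K : Matrix ι ι ℂ) :
    (Kᴴ * compression Φ P G * K).trace = (P * pencil Φ (fun i => G i * K)).trace := by
  simp only [compression, pencil, Matrix.mul_sum, Matrix.sum_mul, trace_sum, Matrix.mul_smul,
    Matrix.smul_mul, trace_smul]
  refine Finset.sum_congr rfl fun i _ => Finset.sum_congr rfl fun j _ => ?_
  congr 1
  rw [conjTranspose_mul, ← Matrix.mul_assoc P, trace_mul_comm (P * (G j * K))]
  simp only [Matrix.mul_assoc]

omit [Fintype n] in
theorem isHermitian_pencil {r : Type*} [Fintype r] {Φ : Matrix (Fin 2) (Fin 2) ℂ}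
    (hΦ : Φ.IsHermitian) (W : Fin 2 → Matrix n r ℂ) : (pencil Φ W).IsHermitian := by
  rw [IsHermitian, pencil]
  simp only [conjTranspose_sum, conjTranspose_smul, conjTranspose_mul, conjTranspose_conjTranspose,
    hΦ.apply]
  rw [Finset.sum_comm]

omit [Fintype ι] in
theorem isHermitian_compression {Φ : Matrix (Fin 2) (Fin 2) ℂ} (hΦ : Φ.IsHermitian)
    {P : Matrix n n ℂ} (hP : P.IsHermitian) (G : Fin 2 → Matrix n ι ℂ) :
    (compression Φ P G).IsHermitian := by
  rw [IsHermitian, compression]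
  simp only [conjTranspose_sum, conjTranspose_smul, conjTranspose_mul, conjTranspose_conjTranspose,
    hΦ.apply, hP.eq, Matrix.mul_assoc]
  rw [Finset.sum_comm]

omit [Fintype ι] in
theorem compression_add (Φ : Matrix (Fin 2) (Fin 2) ℂ) (P Q : Matrix n n ℂ)
    (G : Fin 2 → Matrix n ι ℂ) :
    compression Φ (P + Q) G = compression Φ P G + compression Φ Q G := by
  simp only [compression, Matrix.mul_add, Matrix.add_mul, smul_add, Finset.sum_add_distrib]

omit [Fintype ι] in
theorem compression_smul (Φ : Matrix (Fin 2) (Fin 2) ℂ) (c : ℝ) (P : Matrix n n ℂ)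
    (G : Fin 2 → Matrix n ι ℂ) :
    compression Φ (c • P) G = c • compression Φ P G := by
  simp only [compression, Matrix.mul_smul, Matrix.smul_mul, Finset.smul_sum, smul_comm c]

/-- The matrices with negative definite Hermitian part. -/
def strictlyDissipative (ι : Type*) [Fintype ι] : Set (Matrix ι ι ℂ) :=
  {X | ∀ x : ι → ℂ, x ≠ 0 → (star x ⬝ᵥ (X *ᵥ x)).re < 0}

theorem re_dotProduct_real_smul (c : ℝ) (X : Matrix ι ι ℂ) (x : ι → ℂ) :
    (star x ⬝ᵥ ((c • X) *ᵥ x)).re = c * (star x ⬝ᵥ (X *ᵥ x)).re := by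
  rw [smul_mulVec, dotProduct_smul, Complex.smul_re, smul_eq_mul]

theorem convex_strictlyDissipative : Convex ℝ (strictlyDissipative ι) := by
  intro X hX Y hY a b ha hb hab x hx
  rw [add_mulVec, dotProduct_add, Complex.add_re, re_dotProduct_real_smul,
    re_dotProduct_real_smul]
  have h1 := hX x hx
  have h2 := hY x hx
  rcases ha.eq_or_lt with rfl | ha'
  · have : b = 1 := by linarith
    subst this
    linarith
  · nlinarith

/-- By homogeneity it suffices to test on the unit sphere, whose compactness makes the strict
inequality stable. -/
theorem isOpen_strictlyDissipative : IsOpen (strictlyDissipative ι) := by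
  have e : strictlyDissipative ι =
      {X | ∀ x ∈ Metric.sphere (0 : ι → ℂ) 1, (star x ⬝ᵥ (X *ᵥ x)).re < 0} := by
    ext X
    refine ⟨fun h x hx => h x ?_, fun h x hx => ?_⟩
    · rintro rfl
      simp at hx
    · have hn : (0 : ℝ) < ‖x‖ := norm_pos_iff.2 hx
      have h1 := h (((‖x‖⁻¹ : ℝ) : ℂ) • x) (by
        rw [mem_sphere_zero_iff_norm, norm_smul, Complex.norm_real, norm_inv, norm_norm,
          inv_mul_cancel₀ hn.ne'])
      rw [mulVec_smul, star_smul, smul_dotProduct, dotProduct_smul, smul_smul, RCLike.star_def,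
        Complex.conj_ofReal, ← Complex.ofReal_mul, smul_eq_mul, Complex.re_ofReal_mul] at h1
      have h2 : 0 < ‖x‖⁻¹ * ‖x‖⁻¹ := by positivity
      by_contra! h3
      exact absurd h1 (not_lt.2 (mul_nonneg h2.le h3))
  rw [e, isOpen_iff_eventually]
  intro X hX
  apply (isCompact_sphere (0 : ι → ℂ) 1).eventually_forall_of_forall_eventually
  intro x hx
  have hc : Continuous (fun p : Matrix ι ι ℂ × (ι → ℂ) =>
      (star p.2 ⬝ᵥ (p.1 *ᵥ p.2)).re) := by fun_prop
  exact hc.continuousAt.eventually_lt continuousAt_const (hX x hx)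

variable [DecidableEq ι]

/-- A real linear functional on complex matrices is represented by a matrix. -/
theorem exists_trace_representation (f : Matrix ι ι ℂ →ₗ[ℝ] ℝ) :
    ∃ H : Matrix ι ι ℂ, ∀ X, f X = (X * H).trace.re := by
  -- For `x = a + ib`, one has `a f(E) + b f(iE) = Re (x (f(E) - i f(iE)))`.
  refine ⟨of fun j i => (f (single i j 1) : ℂ) - f (single i j Complex.I) * Complex.I,
    fun X => ?_⟩
  conv_lhs => rw [matrix_eq_sum_single X]
  simp only [map_sum, trace, diag_apply, Matrix.mul_apply, Complex.re_sum, of_apply]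
  refine Finset.sum_congr rfl fun i _ => Finset.sum_congr rfl fun j _ => ?_
  have : single i j (X i j) = (X i j).re • single i j (1 : ℂ)
      + (X i j).im • single i j Complex.I := by
    rw [smul_single, smul_single, ← single_add]
    congr 1
    apply Complex.ext <;> simp
  rw [this, map_add, map_smul, map_smul]
  simp

omit [DecidableEq ι] in
theorem trace_vecMulVec_mul (x : ι → ℂ) (H : Matrix ι ι ℂ) :
    (vecMulVec x (star x) * H).trace = star x ⬝ᵥ (H *ᵥ x) := by
  rw [vecMulVec_mul, trace_vecMulVec, dotProduct_comm, ← dotProduct_mulVec]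

theorem exists_eq_mul_conjTranspose {H : Matrix ι ι ℂ} (hH : H.PosSemidef) :
    ∃ K : Matrix ι ι ℂ, H = K * Kᴴ := by
  obtain ⟨U, -, d, hs, hd⟩ := exists_unitary_diagonalization hH.1
  refine ⟨U * diagonal (fun i => ((√(d i) : ℝ) : ℂ)), ?_⟩
  rw [conjTranspose_mul, diagonal_conjTranspose, ← Matrix.mul_assoc, Matrix.mul_assoc U,
    diagonal_mul_diagonal, hs]
  congr 3
  ext i
  rw [Pi.star_apply, RCLike.star_def, Complex.conj_ofReal, ← Complex.ofReal_mul,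
    Real.mul_self_sqrt (hd hH i)]

omit [DecidableEq ι] in
theorem re_trace_mul_of_isHermitian {X : Matrix ι ι ℂ} (hX : X.IsHermitian) (H : Matrix ι ι ℂ) :
    (X * H).trace.re = (X * ((1 / 2 : ℂ) • (H + Hᴴ))).trace.re := by
  have h1 : (X * Hᴴ).trace = star (X * H).trace := by
    rw [← trace_conjTranspose, conjTranspose_mul, hX.eq, trace_mul_comm]
  rw [Matrix.mul_smul, trace_smul, Matrix.mul_add, trace_add, h1]
  simp
  ring

/-- The case of large `c`, where the slope dominates the constant term. -/
theorem nonneg_of_forall_mul_add {a b : ℝ} (h : ∀ c : ℝ, 0 < c → 0 ≤ c * a + b) : 0 ≤ a := by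
  by_contra! ha
  have h1 := h ((|b| + 1) / -a) (div_pos (by positivity) (by linarith))
  have hne := ha.ne
  have h2 : (|b| + 1) / -a * a = -(|b| + 1) := by
    field_simp
  rw [h2] at h1
  linarith [le_abs_self b]

/-- The case of small `c`, where only the constant term survives. -/
theorem nonneg_of_forall_add_mul {a b : ℝ} (h : ∀ c : ℝ, 0 < c → 0 ≤ c * a + b) : 0 ≤ b := by
  by_contra! hb
  have h1 := h (-b / (2 * (|a| + 1))) (div_pos (by linarith) (by positivity))
  have h2 : -b / (2 * (|a| + 1)) * a ≤ -b / (2 * (|a| + 1)) * (|a| + 1) :=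
    mul_le_mul_of_nonneg_left (by linarith [le_abs_self a])
      (div_nonneg (by linarith) (by positivity))
  have h3 : -b / (2 * (|a| + 1)) * (|a| + 1) = -b / 2 := by
    field_simp
  linarith

omit [DecidableEq ι] in
theorem neg_posDef_of_mem_strictlyDissipative {X : Matrix ι ι ℂ} (hX : X.IsHermitian)
    (h : X ∈ strictlyDissipative ι) : (-X).PosDef := by
  apply PosDef.of_dotProduct_mulVec_pos hX.neg
  intro x hx
  rw [neg_mulVec, dotProduct_neg]
  have him : (star x ⬝ᵥ (X *ᵥ x)).im = 0 := hX.im_star_dotProduct_mulVec_self x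
  rw [Complex.lt_def]
  simp only [Complex.zero_re, Complex.neg_re, Complex.zero_im, Complex.neg_im, him]
  exact ⟨by linarith [h x hx], by simp⟩

/-- If the linear matrix inequality has no solution, then the dual one has. -/
theorem exists_dual_of_infeasible [DecidableEq n] {Φ Ψ : Matrix (Fin 2) (Fin 2) ℂ}
    (hΦ : Φ.IsHermitian) (hΨ : Ψ.IsHermitian) {Θ : Matrix ι ι ℂ} (hΘ : Θ.IsHermitian)
    (G : Fin 2 → Matrix n ι ℂ)
    (hinf : ¬ ∃ P Q : Matrix n n ℂ, P.IsHermitian ∧ Q.PosDef ∧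
      (-(compression Φ P G + compression Ψ Q G + Θ)).PosDef) :
    ∃ K : Matrix ι ι ℂ, K ≠ 0 ∧ pencil Φ (fun i => G i * K) = 0 ∧
      (pencil Ψ (fun i => G i * K)).PosSemidef ∧ 0 ≤ (Kᴴ * Θ * K).trace.re := by
  set T : Set (Matrix ι ι ℂ) := {X | ∃ P Q : Matrix n n ℂ, P.IsHermitian ∧ Q.PosDef ∧
    X = compression Φ P G + compression Ψ Q G + Θ} with hT
  have hTc : Convex ℝ T := by
    rintro _ ⟨P, Q, hP, hQ, rfl⟩ _ ⟨P', Q', hP', hQ', rfl⟩ a b ha hb hab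
    refine ⟨a • P + b • P', a • Q + b • Q', ?_, ?_, ?_⟩
    · exact (hP.smul (IsSelfAdjoint.all a)).add (hP'.smul (IsSelfAdjoint.all b))
    · rcases ha.eq_or_lt with rfl | ha'
      · have : b = 1 := by linarith
        subst this
        simpa using hQ'
      · exact (hQ.smul ha').add_posSemidef (hQ'.posSemidef.smul hb)
    · have : Θ = a • Θ + b • Θ := by rw [← add_smul, hab, one_smul]
      rw [compression_add, compression_add, compression_smul, compression_smul, compression_smul,
        compression_smul]
      conv_rhs => rw [this]
      simp only [smul_add]
      abel
  have hdisj : Disjoint (strictlyDissipative ι) T := by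
    rw [Set.disjoint_left]
    rintro X hX ⟨P, Q, hP, hQ, rfl⟩
    exact hinf ⟨P, Q, hP, hQ, neg_posDef_of_mem_strictlyDissipative
      (((isHermitian_compression hΦ hP G).add (isHermitian_compression hΨ hQ.1 G)).add hΘ) hX⟩
  -- The cone includes non-Hermitian matrices, which makes it open in the full matrix space. Only
  -- Hermitian arguments matter later, so the representing matrix can be replaced by its Hermitian
  -- part.
  obtain ⟨f, u, hfs, hfT⟩ := geometric_hahn_banach_open convex_strictlyDissipative
    isOpen_strictlyDissipative hTc hdisj
  obtain ⟨H₀, hH₀⟩ := exists_trace_representation (f : Matrix ι ι ℂ →ₗ[ℝ] ℝ)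
  set H : Matrix ι ι ℂ := (1 / 2 : ℂ) • (H₀ + H₀ᴴ) with hHdef
  have hf : ∀ X : Matrix ι ι ℂ, X.IsHermitian → f X = (X * H).trace.re := by
    intro X hX
    rw [hHdef, ← re_trace_mul_of_isHermitian hX]
    exact hH₀ X
  have hHh : H.IsHermitian := by
    rw [IsHermitian, hHdef, conjTranspose_smul, conjTranspose_add, conjTranspose_conjTranspose,
      add_comm]
    simp
  have hneg : ∀ X : Matrix ι ι ℂ, X.PosSemidef → ∀ ε : ℝ, 0 < ε →
      (-(X + ε • (1 : Matrix ι ι ℂ))) ∈ strictlyDissipative ι := by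
    intro X hX ε hε x hx
    have h1 := (PosDef.posSemidef_add hX
      ((PosDef.one (n := ι) (R := ℂ)).smul hε)).re_dotProduct_pos hx
    rw [neg_mulVec, dotProduct_neg, Complex.neg_re]
    exact neg_neg_of_pos h1
  have hu : 0 ≤ u := by
    have : ∀ c : ℝ, 0 < c → 0 ≤ c * f 1 + u := by
      intro c hc
      have := hfs _ (hneg 0 PosSemidef.zero c hc)
      rw [zero_add, map_neg, map_smul, smul_eq_mul] at this
      linarith
    exact nonneg_of_forall_add_mul this
  have hHp : H.PosSemidef := by
    apply PosSemidef.of_dotProduct_mulVec_nonneg hHh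
    intro x
    rw [Complex.le_def]
    refine ⟨?_, (hHh.im_star_dotProduct_mulVec_self x).symm⟩
    rw [Complex.zero_re, ← trace_vecMulVec_mul, ← hf _ (posSemidef_vecMulVec_self_star x).1]
    apply nonneg_of_forall_mul_add (b := f 1 + u)
    intro c hc
    have := hfs _ (hneg (c • vecMulVec x (star x))
      ((posSemidef_vecMulVec_self_star x).smul hc.le) 1 one_pos)
    rw [one_smul, map_neg, map_add, map_smul, smul_eq_mul] at this
    linarith
  obtain ⟨K, hK⟩ := exists_eq_mul_conjTranspose hHp
  have htr : ∀ X : Matrix ι ι ℂ, X.IsHermitian → f X = (Kᴴ * X * K).trace.re := by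
    intro X hX
    rw [hf X hX, hK, ← Matrix.mul_assoc, trace_mul_comm, Matrix.mul_assoc]
  have hval : ∀ P Q : Matrix n n ℂ, P.IsHermitian → Q.PosDef →
      0 ≤ (P * pencil Φ (fun i => G i * K)).trace.re +
        (Q * pencil Ψ (fun i => G i * K)).trace.re + (Kᴴ * Θ * K).trace.re := by
    intro P Q hP hQ
    have h1 := hfT _ ⟨P, Q, hP, hQ, rfl⟩
    rw [map_add, map_add, htr _ (isHermitian_compression hΦ hP G),
      htr _ (isHermitian_compression hΨ hQ.1 G), htr _ hΘ, trace_compression,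
      trace_compression] at h1
    linarith
  refine ⟨K, ?_, ?_, ?_, ?_⟩
  -- With `K = 0` the functional vanishes on Hermitian matrices, and separation gives both `0 < u`
  -- and `u ≤ 0`.
  · rintro rfl
    have h1 := hfs _ (hneg 0 PosSemidef.zero 1 one_pos)
    have h2 := hfT _ ⟨0, 1, isHermitian_zero, PosDef.one, rfl⟩
    have hz : ∀ X : Matrix ι ι ℂ, X.IsHermitian → f X = 0 := by
      intro X hX
      rw [htr X hX]
      simp
    rw [hz _ (((isHermitian_compression hΦ isHermitian_zero G).add
      (isHermitian_compression hΨ PosDef.one.1 G)).add hΘ)] at h2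
    rw [zero_add, one_smul, map_neg, hz 1 isHermitian_one] at h1
    linarith
  · set M := pencil Φ (fun i => G i * K) with hM
    have hMh : M.IsHermitian := isHermitian_pencil hΦ _
    have h0 : 0 ≤ (M * M).trace := by
      have := (posSemidef_conjTranspose_mul_self M).trace_nonneg
      rwa [hMh.eq] at this
    have h1 : 0 ≤ -(M * M).trace.re := by
      apply nonneg_of_forall_mul_add
        (b := (1 * pencil Ψ (fun i => G i * K)).trace.re + (Kᴴ * Θ * K).trace.re)
      intro c hc
      -- `P` is arbitrary Hermitian, so it may be aimed against the pencil itself, giving `-c · tr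
      -- M²` for every `c > 0`.
      have := hval ((-c) • M) 1 (hMh.smul (IsSelfAdjoint.all (-c))) PosDef.one
      rw [Matrix.smul_mul, trace_smul, Complex.smul_re, smul_eq_mul] at this
      linarith
    have h2 : (M * M).trace = 0 := by
      rw [Complex.le_def] at h0
      apply Complex.ext
      · exact le_antisymm (by simpa using h1) h0.1
      · exact h0.2.symm
    rw [← trace_conjTranspose_mul_self_eq_zero_iff, hMh.eq, h2]
  · set M := pencil Ψ (fun i => G i * K) with hM
    have hMh : M.IsHermitian := isHermitian_pencil hΨ _
    apply PosSemidef.of_dotProduct_mulVec_nonneg hMh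
    intro x
    rw [Complex.le_def]
    refine ⟨?_, (hMh.im_star_dotProduct_mulVec_self x).symm⟩
    rw [Complex.zero_re, ← trace_vecMulVec_mul]
    apply nonneg_of_forall_mul_add (b := (1 * M).trace.re + (Kᴴ * Θ * K).trace.re)
    intro c hc
    have := hval 0 (c • vecMulVec x (star x) + 1) isHermitian_zero
      (PosDef.posSemidef_add ((posSemidef_vecMulVec_self_star x).smul hc.le) PosDef.one)
    rw [Matrix.zero_mul, trace_zero, Complex.zero_re, Matrix.add_mul, trace_add, Complex.add_re,
      Matrix.smul_mul, trace_smul, Complex.smul_re, smul_eq_mul] at this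
    linarith
  · apply nonneg_of_forall_add_mul (a := (1 * pencil Ψ (fun i => G i * K)).trace.re)
    intro c hc
    have := hval 0 (c • 1) isHermitian_zero (PosDef.one.smul hc)
    rw [Matrix.zero_mul, trace_zero, Complex.zero_re, Matrix.smul_mul, trace_smul,
      Complex.smul_re, smul_eq_mul] at this
    linarith

end Separation

/-! ### Geometry of `Λ` in the plane and normal form of `Φ`. -/

section Geometry

/-- The value of the Hermitian form `Φ` at a vector. -/
def formValue (Φ : Matrix (Fin 2) (Fin 2) ℂ) (v : Fin 2 → ℂ) : ℂ := star v ⬝ᵥ (Φ *ᵥ v)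

/-- The real polynomial in the coordinates of `lam` that equals `delta lam Φ`. -/
def realDelta (Φ : Matrix (Fin 2) (Fin 2) ℂ) (lam : ℂ) : ℝ :=
  (Φ 0 0).re * (lam.re ^ 2 + lam.im ^ 2)
    + 2 * ((Φ 0 1).re * lam.re + (Φ 0 1).im * lam.im) + (Φ 1 1).re

theorem im_diag_eq_zero {Φ : Matrix (Fin 2) (Fin 2) ℂ} (hΦ : Φ.IsHermitian) (i : Fin 2) :
    (Φ i i).im = 0 := by
  have := congrArg Complex.im (hΦ.apply i i)
  simp only [RCLike.star_def, Complex.conj_im] at this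
  linarith

theorem delta_eq_realDelta {Φ : Matrix (Fin 2) (Fin 2) ℂ} (hΦ : Φ.IsHermitian) (lam : ℂ) :
    delta lam Φ = (realDelta Φ lam : ℂ) := by
  have h0 := im_diag_eq_zero hΦ 0
  have h1 := im_diag_eq_zero hΦ 1
  have h2 := hΦ.apply 1 0
  rw [delta, realDelta]
  simp only [dotProduct, mulVec, Fin.sum_univ_two, Pi.star_apply, cons_val_zero, cons_val_one,
    RCLike.star_def, map_one, one_mul, mul_one, ← h2]
  apply Complex.ext <;>
    simp [h0, h1, pow_two] <;> ring

theorem mem_Lam_iff {Φ Ψ : Matrix (Fin 2) (Fin 2) ℂ} (hΦ : Φ.IsHermitian) (hΨ : Ψ.IsHermitian)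
    {lam : ℂ} : lam ∈ Lam Φ Ψ ↔ realDelta Φ lam = 0 ∧ 0 ≤ realDelta Ψ lam := by
  rw [Lam, Set.mem_ofPred_eq, delta_eq_realDelta hΦ, delta_eq_realDelta hΨ]
  norm_cast

theorem continuous_realDelta (Φ : Matrix (Fin 2) (Fin 2) ℂ) : Continuous (realDelta Φ) := by
  unfold realDelta
  fun_prop

theorem sq_add_sq_pos_of_ne {x y : ℂ} (h : x ≠ y) : 0 < (x.re - y.re) ^ 2 + (x.im - y.im) ^ 2 := by
  by_contra! hc
  apply h
  apply Complex.ext <;> nlinarith [sq_nonneg (x.re - y.re), sq_nonneg (x.im - y.im)]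

theorem realDelta_line (Φ : Matrix (Fin 2) (Fin 2) ℂ) (x y : ℂ) (t : ℝ) :
    realDelta Φ (x + t * (y - x)) = realDelta Φ x + t * (realDelta Φ y - realDelta Φ x)
      + (Φ 0 0).re * ((x.re - y.re) ^ 2 + (x.im - y.im) ^ 2) * (t ^ 2 - t) := by
  simp only [realDelta, Complex.add_re, Complex.add_im, Complex.mul_re, Complex.mul_im,
    Complex.ofReal_re, Complex.ofReal_im, Complex.sub_re, Complex.sub_im]
  ring

/-- A polynomial `realDelta Ψ` without positive values and with two zeros vanishes. -/
theorem realDelta_eq_zero_of_nonpos {Ψ : Matrix (Fin 2) (Fin 2) ℂ}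
    (hle : ∀ lam, realDelta Ψ lam ≤ 0) {x y : ℂ} (hxy : x ≠ y) (hx : realDelta Ψ x = 0)
    (hy : realDelta Ψ y = 0) (lam : ℂ) : realDelta Ψ lam = 0 := by
  have hd := sq_add_sq_pos_of_ne hxy
  -- The factor `t² - t` is negative at `1/2` and positive at `2`, so the leading coefficient is
  -- zero. A step from `x` along the gradient then shows that the gradient vanishes.
  have hm := hle (x + (1 / 2 : ℝ) * (y - x))
  have hr := hle (x + (2 : ℝ) * (y - x))
  rw [realDelta_line, hx, hy] at hm hr
  have hp : (Ψ 0 0).re = 0 := by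
    have : (Ψ 0 0).re * ((x.re - y.re) ^ 2 + (x.im - y.im) ^ 2) = 0 := by linarith
    exact (mul_eq_zero.1 this).resolve_right hd.ne'
  have hg := hle ⟨x.re + (Ψ 0 1).re, x.im + (Ψ 0 1).im⟩
  simp only [realDelta, hp] at hg hx
  have h0 : (Ψ 0 1).re ^ 2 + (Ψ 0 1).im ^ 2 ≤ 0 := by linarith
  have ha : (Ψ 0 1).re = 0 := by nlinarith [sq_nonneg (Ψ 0 1).re, sq_nonneg (Ψ 0 1).im]
  have hb : (Ψ 0 1).im = 0 := by nlinarith [sq_nonneg (Ψ 0 1).re, sq_nonneg (Ψ 0 1).im]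
  rw [ha, hb] at hx
  rw [realDelta, hp, ha, hb]
  linarith

/-- If `Λ` has at least two points and no interior, then `det Φ < 0`. -/
theorem discriminant_pos {Φ Ψ : Matrix (Fin 2) (Fin 2) ℂ} (hΦ : Φ.IsHermitian)
    (hΨ : Ψ.IsHermitian) (hnt : (Lam Φ Ψ).Nontrivial) (hint : interior (Lam Φ Ψ) = ∅) :
    0 < (Φ 0 1).re ^ 2 + (Φ 0 1).im ^ 2 - (Φ 0 0).re * (Φ 1 1).re := by
  obtain ⟨x, hx, y, hy, hxy⟩ := hnt
  have hd := sq_add_sq_pos_of_ne hxy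
  rw [mem_Lam_iff hΦ hΨ] at hx hy
  by_contra! hc
  by_cases hp : (Φ 0 0).re = 0
  · rw [hp] at hc
    have ha : (Φ 0 1).re = 0 := by nlinarith [sq_nonneg (Φ 0 1).re, sq_nonneg (Φ 0 1).im]
    have hb : (Φ 0 1).im = 0 := by nlinarith [sq_nonneg (Φ 0 1).re, sq_nonneg (Φ 0 1).im]
    have hs : (Φ 1 1).re = 0 := by
      have := hx.1
      rw [realDelta, hp, ha, hb] at this
      linarith
    have hzero : ∀ lam, realDelta Φ lam = 0 := by
      intro lam
      rw [realDelta, hp, ha, hb, hs]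
      ring
    have hle : ∀ lam, realDelta Ψ lam ≤ 0 := by
      intro lam
      by_contra! hpos
      have hsub : {z | 0 < realDelta Ψ z} ⊆ interior (Lam Φ Ψ) :=
        interior_maximal (fun z hz => (mem_Lam_iff hΦ hΨ).2 ⟨hzero z, le_of_lt hz⟩)
          (isOpen_lt continuous_const (continuous_realDelta Ψ))
      rw [hint] at hsub
      exact hsub hpos
    have hx0 : realDelta Ψ x = 0 := le_antisymm (hle x) hx.2
    have hy0 : realDelta Ψ y = 0 := le_antisymm (hle y) hy.2
    have huniv : Lam Φ Ψ = Set.univ := by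
      ext z
      simp only [Set.mem_univ, iff_true]
      rw [mem_Lam_iff hΦ hΨ]
      exact ⟨hzero z, (realDelta_eq_zero_of_nonpos hle hxy hx0 hy0 z).ge⟩
    rw [huniv, interior_univ] at hint
    exact Set.univ_nonempty.ne_empty hint
  -- Completing squares turns the zero set into a circle of nonpositive squared radius, hence at
  -- most a point.
  · have key : ∀ z, realDelta Φ z = 0 → (Φ 0 0).re * z.re = -(Φ 0 1).re ∧
        (Φ 0 0).re * z.im = -(Φ 0 1).im := by
      intro z hz
      have e : ((Φ 0 0).re * z.re + (Φ 0 1).re) ^ 2 + ((Φ 0 0).re * z.im + (Φ 0 1).im) ^ 2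
          = (Φ 0 1).re ^ 2 + (Φ 0 1).im ^ 2 - (Φ 0 0).re * (Φ 1 1).re := by
        rw [realDelta] at hz
        linear_combination (Φ 0 0).re * hz
      constructor <;>
        nlinarith [sq_nonneg ((Φ 0 0).re * z.re + (Φ 0 1).re),
          sq_nonneg ((Φ 0 0).re * z.im + (Φ 0 1).im)]
    apply hxy
    apply Complex.ext <;> apply mul_left_cancel₀ hp
    · rw [(key x hx.1).1, (key y hy.1).1]
    · rw [(key x hx.1).2, (key y hy.1).2]

/-- Outside the unit disc the negative quadratic term outgrows the remaining terms, which are at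
most linear in `‖z‖`. -/
theorem isBounded_of_quadratic {Φ : Matrix (Fin 2) (Fin 2) ℂ} (hp : (Φ 0 0).re < 0) :
    Bornology.IsBounded {lam | 0 ≤ realDelta Φ lam} := by
  rw [isBounded_iff_forall_norm_le]
  set c := 2 * (|(Φ 0 1).re| + |(Φ 0 1).im|) + |(Φ 1 1).re| with hc
  have hc0 : 0 ≤ c := by positivity
  refine ⟨1 + c / -(Φ 0 0).re, fun z hz => ?_⟩
  have hp' : 0 < -(Φ 0 0).re := by linarith
  rcases le_total ‖z‖ 1 with h1 | h1
  · have : 0 ≤ c / -(Φ 0 0).re := by positivity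
    linarith
  have h2 : ‖z‖ ≤ c / -(Φ 0 0).re := by
    rw [le_div_iff₀ hp']
    rw [Set.mem_ofPred_eq, realDelta] at hz
    have hn : z.re ^ 2 + z.im ^ 2 = ‖z‖ ^ 2 := by
      rw [Complex.sq_norm, Complex.normSq_apply]
      ring
    rw [hn] at hz
    have hb1 : (Φ 0 1).re * z.re ≤ |(Φ 0 1).re| * ‖z‖ :=
      (le_abs_self _).trans (by
        rw [abs_mul]
        exact mul_le_mul_of_nonneg_left (Complex.abs_re_le_norm z) (abs_nonneg _))
    have hb2 : (Φ 0 1).im * z.im ≤ |(Φ 0 1).im| * ‖z‖ :=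
      (le_abs_self _).trans (by
        rw [abs_mul]
        exact mul_le_mul_of_nonneg_left (Complex.abs_im_le_norm z) (abs_nonneg _))
    have hb3 : (Φ 1 1).re ≤ |(Φ 1 1).re| * ‖z‖ :=
      (le_abs_self _).trans (le_mul_of_one_le_right (abs_nonneg _) h1)
    have h3 : ‖z‖ * (‖z‖ * -(Φ 0 0).re) ≤ ‖z‖ * c := by
      rw [hc]
      nlinarith
    exact le_of_mul_le_mul_left h3 (by linarith)
  linarith

theorem realDelta_neg (Φ : Matrix (Fin 2) (Fin 2) ℂ) (lam : ℂ) :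
    realDelta (-Φ) lam = -realDelta Φ lam := by
  simp only [realDelta, Matrix.neg_apply, Complex.neg_re, Complex.neg_im]
  ring

/-- If `Λ` is unbounded, then the point at infinity satisfies the homogeneous conditions. -/
theorem leading_coeff_of_unbounded {Φ Ψ : Matrix (Fin 2) (Fin 2) ℂ} (hΦ : Φ.IsHermitian)
    (hΨ : Ψ.IsHermitian) (h : ¬ Bornology.IsBounded (Lam Φ Ψ)) :
    (Φ 0 0).re = 0 ∧ 0 ≤ (Ψ 0 0).re := by
  constructor
  · by_contra hne
    apply h
    rcases lt_or_gt_of_ne hne with hp | hp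
    · exact (isBounded_of_quadratic hp).subset fun z hz => ((mem_Lam_iff hΦ hΨ).1 hz).1.ge
    · refine (isBounded_of_quadratic (Φ := -Φ) (by simpa using hp)).subset fun z hz => ?_
      rw [Set.mem_ofPred_eq, realDelta_neg, ((mem_Lam_iff hΦ hΨ).1 hz).1, neg_zero]
  · by_contra! hp
    exact h ((isBounded_of_quadratic hp).subset fun z hz => ((mem_Lam_iff hΦ hΨ).1 hz).2)

/-- Conversely, if the point at infinity satisfies the homogeneous conditions, then `Λ` is
unbounded as soon as it has two points. -/
theorem unbounded_of_leading_coeff {Φ Ψ : Matrix (Fin 2) (Fin 2) ℂ} (hΦ : Φ.IsHermitian)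
    (hΨ : Ψ.IsHermitian) (hnt : (Lam Φ Ψ).Nontrivial) (hp : (Φ 0 0).re = 0)
    (hp' : 0 ≤ (Ψ 0 0).re) : ¬ Bornology.IsBounded (Lam Φ Ψ) := by
  obtain ⟨x, hx, y, hy, hxy, hle⟩ : ∃ x ∈ Lam Φ Ψ, ∃ y ∈ Lam Φ Ψ, x ≠ y ∧
      realDelta Ψ x ≤ realDelta Ψ y := by
    obtain ⟨x, hx, y, hy, hxy⟩ := hnt
    rcases le_total (realDelta Ψ x) (realDelta Ψ y) with h | h
    · exact ⟨x, hx, y, hy, hxy, h⟩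
    · exact ⟨y, hy, x, hx, hxy.symm, h⟩
  have hd := sq_add_sq_pos_of_ne hxy
  rw [mem_Lam_iff hΦ hΨ] at hx hy
  intro hb
  rw [isBounded_iff_forall_norm_le] at hb
  obtain ⟨C, hC⟩ := hb
  -- The pair is ordered so that `realDelta Ψ` does not decrease from `x` to `y`; beyond `y` the
  -- quadratic correction is nonnegative too, so the ray stays in `Λ`.
  have hray : ∀ t : ℝ, 1 ≤ t → x + t * (y - x) ∈ Lam Φ Ψ := by
    intro t ht
    rw [mem_Lam_iff hΦ hΨ, realDelta_line, realDelta_line, hx.1, hy.1, hp]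
    refine ⟨by ring, ?_⟩
    have h1 : 0 ≤ t * (realDelta Ψ y - realDelta Ψ x) :=
      mul_nonneg (by linarith) (by linarith)
    have h2 : 0 ≤ (Ψ 0 0).re * ((x.re - y.re) ^ 2 + (x.im - y.im) ^ 2) * (t ^ 2 - t) :=
      mul_nonneg (mul_nonneg hp' hd.le) (by nlinarith)
    linarith [hx.2]
  have hyx : 0 < ‖y - x‖ := norm_pos_iff.2 (sub_ne_zero.2 hxy.symm)
  have hC0 : 0 ≤ C := (norm_nonneg _).trans (hC _ (hray 1 le_rfl))
  set t : ℝ := 1 + (C + ‖x‖) / ‖y - x‖ with ht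
  have ht1 : 1 ≤ t := by
    have : 0 ≤ (C + ‖x‖) / ‖y - x‖ := by positivity
    linarith
  have h1 := hC _ (hray t ht1)
  have h2 : ‖(t : ℂ) * (y - x)‖ ≤ ‖x + t * (y - x)‖ + ‖x‖ := by
    have := norm_sub_le (x + t * (y - x)) x
    rwa [add_sub_cancel_left] at this
  rw [norm_mul, Complex.norm_real, Real.norm_of_nonneg (by linarith)] at h2
  have h3 : t * ‖y - x‖ = ‖y - x‖ + (C + ‖x‖) := by
    rw [ht]
    field_simp
  linarith

theorem formValue_affine (Φ : Matrix (Fin 2) (Fin 2) ℂ) {v : Fin 2 → ℂ} (hv : v 1 ≠ 0) :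
    formValue Φ v = (Complex.normSq (v 1) : ℂ) * delta (v 0 / v 1) Φ := by
  simp only [formValue, delta, dotProduct, mulVec, Fin.sum_univ_two, Pi.star_apply,
    cons_val_zero, cons_val_one, RCLike.star_def, map_one, one_mul, mul_one, map_div₀,
    ← Complex.mul_conj]
  have : (starRingEnd ℂ) (v 1) ≠ 0 := by simpa using hv
  field_simp

theorem formValue_infinite (Φ : Matrix (Fin 2) (Fin 2) ℂ) {v : Fin 2 → ℂ} (hv : v 1 = 0) :
    formValue Φ v = (Complex.normSq (v 0) : ℂ) * Φ 0 0 := by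
  simp only [formValue, dotProduct, mulVec, Fin.sum_univ_two, Pi.star_apply, hv,
    RCLike.star_def, map_zero, zero_mul, mul_zero, add_zero, ← Complex.mul_conj]
  ring

/-- A Hermitian `2 × 2` matrix of negative determinant is congruent to a multiple of the
standard skew form. -/
theorem exists_congruence {Φ : Matrix (Fin 2) (Fin 2) ℂ} (hΦ : Φ.IsHermitian)
    (hdet : 0 < (Φ 0 1).re ^ 2 + (Φ 0 1).im ^ 2 - (Φ 0 0).re * (Φ 1 1).re) :
    ∃ (T : Matrix (Fin 2) (Fin 2) ℂ) (κ : ℝ), IsUnit T.det ∧ κ ≠ 0 ∧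
      Tᴴ * Φ * T = (κ : ℂ) • !![0, Complex.I; -Complex.I, 0] := by
  obtain ⟨p, q, s, rfl⟩ : ∃ (p : ℝ) (q : ℂ) (s : ℝ),
      Φ = !![(p : ℂ), q; (starRingEnd ℂ) q, (s : ℂ)] := by
    refine ⟨(Φ 0 0).re, Φ 0 1, (Φ 1 1).re, ?_⟩
    ext i j
    fin_cases i <;> fin_cases j
    · exact Complex.ext (by simp) (by simpa using im_diag_eq_zero hΦ 0)
    · simp
    · simpa using (hΦ.apply 1 0).symm
    · exact Complex.ext (by simp) (by simpa using im_diag_eq_zero hΦ 1)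
  simp only [of_apply, cons_val_zero, cons_val_one, cons_val', cons_val_fin_one,
    Complex.ofReal_re] at hdet
  have hq : q * (starRingEnd ℂ) q = ((q.re ^ 2 + q.im ^ 2 : ℝ) : ℂ) := by
    rw [Complex.mul_conj, Complex.normSq_apply]
    congr 1
    ring
  -- The columns of `T` are independent isotropic vectors of `Φ`: infinity and a point of the line
  -- if `p = 0`, two opposite points of the circle otherwise. The factor `Complex.I` in the first
  -- column makes the off-diagonal entries imaginary.
  by_cases hp : p = 0
  · subst hp
    have hN : 0 < q.re ^ 2 + q.im ^ 2 := by linarith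
    set N : ℝ := q.re ^ 2 + q.im ^ 2 with hNdef
    have hNc : (N : ℂ) ≠ 0 := by exact_mod_cast hN.ne'
    have hq0 : q ≠ 0 := by
      rintro rfl
      simp at hq
      exact hNc hq.symm
    refine ⟨!![Complex.I * q, -(s * q / (2 * N)); 0, 1], -N, ?_, by simpa using hN.ne', ?_⟩
    · rw [det_fin_two_of, isUnit_iff_ne_zero]
      simpa using hq0
    · ext i j
      fin_cases i <;> fin_cases j <;>
        simp [Matrix.mul_apply, Fin.sum_univ_two]
      · linear_combination Complex.I * hq
      · linear_combination Complex.I * hq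
      · field_simp
        rw [map_ofNat]
        linear_combination (-4 * (s : ℂ)) * hq
  · set d : ℝ := √(q.re ^ 2 + q.im ^ 2 - p * s) with hd
    have hd0 : 0 < d := Real.sqrt_pos.2 hdet
    have hdd : d ^ 2 = q.re ^ 2 + q.im ^ 2 - p * s := Real.sq_sqrt hdet.le
    have hq' : q * (starRingEnd ℂ) q = (d : ℂ) ^ 2 + p * s := by
      rw [hq, ← Complex.ofReal_pow, hdd]
      push_cast
      ring
    have hpc : (p : ℂ) ≠ 0 := by exact_mod_cast hp
    have hdc : (d : ℂ) ≠ 0 := by exact_mod_cast hd0.ne'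
    refine ⟨!![Complex.I * ((-q + d) / p), (-q - d) / p; Complex.I, 1], 2 * d ^ 2 / p, ?_,
      by positivity, ?_⟩
    · rw [det_fin_two_of, isUnit_iff_ne_zero]
      have : Complex.I * ((-q + d) / p) * 1 - (-q - d) / p * Complex.I
          = Complex.I * (2 * d / p) := by
        field_simp
        ring
      rw [this]
      simp [hpc, hdc]
    · ext i j
      fin_cases i <;> fin_cases j <;>
        simp [Matrix.mul_apply, Fin.sum_univ_two] <;> field_simp
      · linear_combination Complex.I ^ 2 * hq'
      · linear_combination hq'
      · linear_combination -hq'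
      · linear_combination -hq'

end Geometry

/-! ### Reduction to real quadratic forms and the decomposition of pencils. -/

section RealForms

/-- An indefinite real binary quadratic form is a product of two independent linear forms. -/
theorem exists_linear_factors {α β γ : ℝ} (h : 0 < β ^ 2 - α * γ) :
    ∃ l₀ l₁ m₀ m₁ : ℝ, l₀ * m₁ - l₁ * m₀ ≠ 0 ∧ α = l₀ * m₀ ∧ 2 * β = l₀ * m₁ + l₁ * m₀ ∧
      γ = l₁ * m₁ := by
  by_cases hα : α = 0
  · subst hα
    refine ⟨0, 1, 2 * β, γ, ?_, by ring, by ring, by ring⟩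
    have : β ≠ 0 := by
      rintro rfl
      simp at h
    simpa using this
  · obtain ⟨s, hs, hss⟩ : ∃ s : ℝ, 0 < s ∧ s ^ 2 = β ^ 2 - α * γ :=
      ⟨√(β ^ 2 - α * γ), Real.sqrt_pos.2 h, Real.sq_sqrt h.le⟩
    refine ⟨α, β + s, 1, (β - s) / α, ?_, by ring, ?_, ?_⟩
    · have : α * ((β - s) / α) - (β + s) * 1 = -(2 * s) := by
        field_simp
        ring
      rw [this]
      exact neg_ne_zero.2 (by positivity)
    · field_simp
      ring
    · field_simp
      linear_combination hss

variable {n r : Type*} [Fintype n] [Fintype r] [DecidableEq n] [DecidableEq r]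

/-- Simultaneous reduction of `Y` and `Z` when a real quadratic form is imposed on them. -/
theorem exists_unitary_of_quadratic {Y Z : Matrix n r ℂ} (hR : (Y * Zᴴ).IsHermitian)
    {α β γ : ℝ} (hcases : 0 < β ^ 2 - α * γ ∨ (β ^ 2 - α * γ ≤ 0 ∧ 0 ≤ α ∧ 0 ≤ γ))
    (hp : ((α : ℂ) • (Y * Yᴴ) + (2 * β : ℂ) • (Y * Zᴴ) + (γ : ℂ) • (Z * Zᴴ)).PosSemidef) :
    ∃ U ∈ unitaryGroup r ℂ, ∃ (V : Matrix n r ℂ) (a b : r → ℝ), (∀ j, a j ≠ 0 ∨ b j ≠ 0) ∧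
      (∀ j, 0 ≤ α * a j ^ 2 + 2 * β * (a j * b j) + γ * b j ^ 2) ∧
      Y * U = V * diagonal (fun j => (a j : ℂ)) ∧ Z * U = V * diagonal (fun j => (b j : ℂ)) := by
  rcases hcases with h | ⟨h, hα, hγ⟩
  · obtain ⟨l₀, l₁, m₀, m₁, hne, h0, h1, h2⟩ := exists_linear_factors h
    have hZY : Z * Yᴴ = Y * Zᴴ := by
      have := hR.eq
      rwa [conjTranspose_mul, conjTranspose_conjTranspose] at this
    -- The factorization of the scalar form lifts to matrices because `Y Zᴴ` is Hermitian. Cramer's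
    -- rule later recovers `Y` and `Z` from the two linear forms.
    have e : ((l₀ : ℂ) • Y + (l₁ : ℂ) • Z) * ((m₀ : ℂ) • Y + (m₁ : ℂ) • Z)ᴴ
        = (α : ℂ) • (Y * Yᴴ) + (2 * β : ℂ) • (Y * Zᴴ) + (γ : ℂ) • (Z * Zᴴ) := by
      have h1c : (2 * β : ℂ) = l₀ * m₁ + l₁ * m₀ := by exact_mod_cast h1
      rw [h1c, h0, h2]
      simp only [conjTranspose_add, conjTranspose_smul, Matrix.mul_add, Matrix.add_mul,
        Matrix.mul_smul, Matrix.smul_mul, hZY, RCLike.star_def, Complex.conj_ofReal,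
        Complex.ofReal_mul]
      module
    rw [← e] at hp
    obtain ⟨U, hU, V, a, b, hab, hY, hZ⟩ := exists_unitary_of_posSemidef hp
    set Δ : ℝ := l₀ * m₁ - l₁ * m₀ with hΔ
    have hΔc : (Δ : ℂ) ≠ 0 := by exact_mod_cast hne
    have hΔc' : (Δ : ℂ) = l₀ * m₁ - l₁ * m₀ := by rw [hΔ]; push_cast; ring
    refine ⟨U, hU, V, fun j => (m₁ * a j - l₁ * b j) / Δ, fun j => (l₀ * b j - m₀ * a j) / Δ,
      ?_, ?_, ?_, ?_⟩
    · intro j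
      by_contra! hc
      obtain ⟨hc1, hc2⟩ := hc
      rw [div_eq_zero_iff, or_iff_left hne] at hc1 hc2
      have ha : Δ * a j = 0 := by rw [hΔ]; linear_combination l₀ * hc1 + l₁ * hc2
      have hb : Δ * b j = 0 := by rw [hΔ]; linear_combination m₀ * hc1 + m₁ * hc2
      have ha' := (mul_eq_zero.1 ha).resolve_left hne
      have hb' := (mul_eq_zero.1 hb).resolve_left hne
      have := (hab j).2.2
      rw [ha', hb'] at this
      norm_num at this
    · intro j
      have e1 : l₀ * ((m₁ * a j - l₁ * b j) / Δ) + l₁ * ((l₀ * b j - m₀ * a j) / Δ) = a j := by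
        field_simp
        rw [hΔ]
        ring
      have e2 : m₀ * ((m₁ * a j - l₁ * b j) / Δ) + m₁ * ((l₀ * b j - m₀ * a j) / Δ) = b j := by
        field_simp
        rw [hΔ]
        ring
      have := mul_nonneg (hab j).1 (hab j).2.1
      dsimp only
      generalize (m₁ * a j - l₁ * b j) / Δ = x at *
      generalize (l₀ * b j - m₀ * a j) / Δ = y at *
      rw [← e1, ← e2] at this
      rw [h1, h0, h2]
      linarith
    all_goals
      ext i j
      have hYij := congrFun (congrFun hY i) j
      have hZij := congrFun (congrFun hZ i) j
      simp only [mul_diagonal, Matrix.add_mul, Matrix.smul_mul, Matrix.add_apply,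
        Matrix.smul_apply, smul_eq_mul, Complex.ofReal_sub, Complex.ofReal_mul,
        Complex.ofReal_div] at hYij hZij ⊢
      rw [mul_div_assoc', eq_div_iff hΔc, hΔc']
    · linear_combination (m₁ : ℂ) * hYij - l₁ * hZij
    · linear_combination (l₀ : ℂ) * hZij - m₀ * hYij
  -- The form is positive semidefinite here, so any real `a j`, `b j` satisfy the inequality.
  · obtain ⟨U, hU, V, a, b, hab, hY, hZ⟩ := exists_unitary_of_isHermitian hR
    refine ⟨U, hU, V, a, b, hab, fun j => ?_, hY, hZ⟩
    rcases hα.eq_or_lt with rfl | hα'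
    · have hβ : β = 0 := by nlinarith [sq_nonneg β]
      rw [hβ]
      nlinarith [mul_nonneg hγ (sq_nonneg (b j))]
    · have h1 : α * (α * a j ^ 2 + 2 * β * (a j * b j) + γ * b j ^ 2)
          = (α * a j + β * b j) ^ 2 + (α * γ - β ^ 2) * b j ^ 2 := by ring
      have h2 : 0 ≤ α * (α * a j ^ 2 + 2 * β * (a j * b j) + γ * b j ^ 2) := by
        rw [h1]
        have := mul_nonneg (show 0 ≤ α * γ - β ^ 2 by linarith) (sq_nonneg (b j))
        positivity
      exact nonneg_of_mul_nonneg_right h2 hα'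

omit [Fintype n] [DecidableEq n] [DecidableEq r] in
theorem pencil_congruence (Φ T : Matrix (Fin 2) (Fin 2) ℂ) (W : Fin 2 → Matrix n r ℂ) :
    pencil Φ (fun i => ∑ k, T i k • W k) = pencil (Tᴴ * Φ * T) W := by
  simp only [pencil, Fin.sum_univ_two, conjTranspose_add, conjTranspose_smul, Matrix.mul_add,
    Matrix.add_mul, Matrix.mul_smul, Matrix.smul_mul, Matrix.mul_apply, conjTranspose_apply]
  module

theorem formValue_congruence (Φ T : Matrix (Fin 2) (Fin 2) ℂ) (v : Fin 2 → ℂ) :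
    formValue Φ (T *ᵥ v) = formValue (Tᴴ * Φ * T) v := by
  rw [formValue, formValue, star_mulVec, ← dotProduct_mulVec, mulVec_mulVec, mulVec_mulVec,
    Matrix.mul_assoc]

/-- The value is `2κ Im (v₀ v̄₁)`; in particular real vectors are isotropic. -/
theorem formValue_skew (κ : ℝ) (v : Fin 2 → ℂ) :
    formValue ((κ : ℂ) • !![0, Complex.I; -Complex.I, 0]) v
      = ((κ * (2 * ((v 0).im * (v 1).re - (v 0).re * (v 1).im)) : ℝ) : ℂ) := by
  simp only [formValue, dotProduct, mulVec, Fin.sum_univ_two, Pi.star_apply, Matrix.smul_apply,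
    of_apply, cons_val_zero, cons_val_one, cons_val', cons_val_fin_one, RCLike.star_def]
  apply Complex.ext <;> simp <;> ring

theorem formValue_re {Ψ : Matrix (Fin 2) (Fin 2) ℂ} (hΨ : Ψ.IsHermitian) (v : Fin 2 → ℂ) :
    formValue Ψ v = (((Ψ 0 0).re * ((v 0).re ^ 2 + (v 0).im ^ 2)
      + 2 * (Ψ 0 1).re * ((v 0).re * (v 1).re + (v 0).im * (v 1).im)
      + 2 * (Ψ 0 1).im * ((v 0).im * (v 1).re - (v 0).re * (v 1).im)
      + (Ψ 1 1).re * ((v 1).re ^ 2 + (v 1).im ^ 2) : ℝ) : ℂ) := by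
  have h0 := im_diag_eq_zero hΨ 0
  have h1 := im_diag_eq_zero hΨ 1
  have h2 := hΨ.apply 1 0
  simp only [formValue, dotProduct, mulVec, Fin.sum_univ_two, Pi.star_apply, RCLike.star_def,
    ← h2]
  apply Complex.ext <;> simp [h0, h1, pow_two] <;> ring

/-- If `Λ` has two points, then in coordinates in which `Φ` is skew the real part of `Ψ` is
indefinite or positive semidefinite. -/
theorem indefinite_or_nonneg {Φ Ψ T : Matrix (Fin 2) (Fin 2) ℂ} {κ : ℝ} (hΨ : Ψ.IsHermitian)
    (hnt : (Lam Φ Ψ).Nontrivial) (hT : IsUnit T.det) (hκ : κ ≠ 0)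
    (hΦT : Tᴴ * Φ * T = (κ : ℂ) • !![0, Complex.I; -Complex.I, 0]) :
    0 < ((Tᴴ * Ψ * T) 0 1).re ^ 2 - ((Tᴴ * Ψ * T) 0 0).re * ((Tᴴ * Ψ * T) 1 1).re ∨
      (((Tᴴ * Ψ * T) 0 1).re ^ 2 - ((Tᴴ * Ψ * T) 0 0).re * ((Tᴴ * Ψ * T) 1 1).re ≤ 0 ∧
        0 ≤ ((Tᴴ * Ψ * T) 0 0).re ∧ 0 ≤ ((Tᴴ * Ψ * T) 1 1).re) := by
  by_contra! hcon
  obtain ⟨hdisc, hsign⟩ := hcon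
  replace hsign := hsign hdisc
  have hΨT : (Tᴴ * Ψ * T).IsHermitian := isHermitian_conjTranspose_mul_mul T hΨ
  have hsol : ∀ lam ∈ Lam Φ Ψ, ∃ v : Fin 2 → ℂ, T *ᵥ v = ![lam, 1] ∧
      (v 0).im * (v 1).re - (v 0).re * (v 1).im = 0 ∧
      0 ≤ ((Tᴴ * Ψ * T) 0 0).re * ((v 0).re ^ 2 + (v 0).im ^ 2)
        + 2 * ((Tᴴ * Ψ * T) 0 1).re * ((v 0).re * (v 1).re + (v 0).im * (v 1).im)
        + ((Tᴴ * Ψ * T) 1 1).re * ((v 1).re ^ 2 + (v 1).im ^ 2) := by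
    intro lam hlam
    refine ⟨T⁻¹ *ᵥ ![lam, 1], ?_, ?_⟩
    · rw [mulVec_mulVec, mul_nonsing_inv T hT, one_mulVec]
    set v := T⁻¹ *ᵥ ![lam, 1] with hv
    have hTv : T *ᵥ v = ![lam, 1] := by
      rw [hv, mulVec_mulVec, mul_nonsing_inv T hT, one_mulVec]
    have h1 : formValue Φ ![lam, 1] = 0 := hlam.1
    have h2 : 0 ≤ formValue Ψ ![lam, 1] := hlam.2
    rw [← hTv, formValue_congruence, hΦT, formValue_skew, Complex.ofReal_eq_zero] at h1
    have h3 : (v 0).im * (v 1).re - (v 0).re * (v 1).im = 0 := by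
      have := (mul_eq_zero.1 h1).resolve_left hκ
      linarith
    rw [← hTv, formValue_congruence, formValue_re hΨT, h3, mul_zero, add_zero] at h2
    exact ⟨h3, by exact_mod_cast h2⟩
  generalize ((Tᴴ * Ψ * T) 0 0).re = α at *
  generalize ((Tᴴ * Ψ * T) 0 1).re = β at *
  generalize ((Tᴴ * Ψ * T) 1 1).re = γ at *
  -- The excluded case is a nonzero negative semidefinite form. It is nonnegative only on its
  -- kernel, which a nonzero row of its matrix annihilates.
  have hker : ∃ l : Fin 2 → ℂ, l ≠ 0 ∧ ∀ v : Fin 2 → ℂ,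
      0 ≤ α * ((v 0).re ^ 2 + (v 0).im ^ 2)
        + 2 * β * ((v 0).re * (v 1).re + (v 0).im * (v 1).im)
        + γ * ((v 1).re ^ 2 + (v 1).im ^ 2) → l ⬝ᵥ v = 0 := by
    rcases lt_or_ge α 0 with hα | hα
    · refine ⟨![α, β], fun h => hα.ne (by simpa using congrFun h 0), fun v hv => ?_⟩
      have e := mul_nonpos_of_nonpos_of_nonneg hα.le hv
      have h1 : 0 ≤ (α * γ - β ^ 2) * ((v 1).re ^ 2 + (v 1).im ^ 2) :=
        mul_nonneg (by linarith) (by positivity)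
      have h2 : (α * (v 0).re + β * (v 1).re) ^ 2 + (α * (v 0).im + β * (v 1).im) ^ 2 ≤ 0 := by
        linarith
      rw [dotProduct, Fin.sum_univ_two]
      apply Complex.ext <;>
        simp <;> nlinarith [sq_nonneg (α * (v 0).re + β * (v 1).re),
          sq_nonneg (α * (v 0).im + β * (v 1).im)]
    · have hγ := hsign hα
      refine ⟨![β, γ], fun h => hγ.ne (by simpa using congrFun h 1), fun v hv => ?_⟩
      have e := mul_nonpos_of_nonpos_of_nonneg hγ.le hv
      have h1 : 0 ≤ (α * γ - β ^ 2) * ((v 0).re ^ 2 + (v 0).im ^ 2) :=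
        mul_nonneg (by linarith) (by positivity)
      have h2 : (β * (v 0).re + γ * (v 1).re) ^ 2 + (β * (v 0).im + γ * (v 1).im) ^ 2 ≤ 0 := by
        linarith
      rw [dotProduct, Fin.sum_univ_two]
      apply Complex.ext <;>
        simp <;> nlinarith [sq_nonneg (β * (v 0).re + γ * (v 1).re),
          sq_nonneg (β * (v 0).im + γ * (v 1).im)]
  obtain ⟨l, hl, hlv⟩ := hker
  -- Pulled back to `(λ, 1)`, this is a nonzero functional of degree at most one in `λ`, so it
  -- cannot vanish at two points.
  have hl' : ∀ lam ∈ Lam Φ Ψ, (l ᵥ* T⁻¹) ⬝ᵥ ![lam, 1] = 0 := by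
    intro lam hlam
    obtain ⟨v, hTv, -, hv⟩ := hsol lam hlam
    rw [← hTv, ← dotProduct_mulVec, mulVec_mulVec, nonsing_inv_mul T hT, one_mulVec]
    exact hlv v hv
  obtain ⟨x, hx, y, hy, hxy⟩ := hnt
  have hx := hl' x hx
  have hy := hl' y hy
  set c := l ᵥ* T⁻¹ with hc
  simp only [dotProduct, Fin.sum_univ_two, cons_val_zero, cons_val_one, mul_one] at hx hy
  have hc0 : c 0 = 0 := by
    have : c 0 * (x - y) = 0 := by linear_combination hx - hy
    exact (mul_eq_zero.1 this).resolve_right (sub_ne_zero.2 hxy)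
  have hc1 : c 1 = 0 := by rw [hc0, zero_mul, zero_add] at hx; exact hx
  apply hl
  have : l = c ᵥ* T := by rw [hc, vecMul_vecMul, nonsing_inv_mul T hT, vecMul_one]
  have hcz : c = 0 := by
    ext i
    fin_cases i
    · exact hc0
    · exact hc1
  rw [this, hcz, zero_vecMul]

/-- Simultaneous decomposition of a pair of matrices satisfying the two block conditions into
columns satisfying the corresponding scalar conditions. -/
theorem exists_unitary_of_pencil {Φ Ψ : Matrix (Fin 2) (Fin 2) ℂ} (hΦ : Φ.IsHermitian)
    (hΨ : Ψ.IsHermitian) (hnt : (Lam Φ Ψ).Nontrivial) (hint : interior (Lam Φ Ψ) = ∅)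
    (W : Fin 2 → Matrix n r ℂ) (h0 : pencil Φ W = 0) (h1 : (pencil Ψ W).PosSemidef) :
    ∃ U ∈ unitaryGroup r ℂ, ∃ (V : Matrix n r ℂ) (v : r → Fin 2 → ℂ),
      (∀ j, v j ≠ 0 ∧ formValue Φ (v j) = 0 ∧ 0 ≤ formValue Ψ (v j)) ∧
      ∀ i, W i * U = V * diagonal (fun j => v j i) := by
  obtain ⟨T, κ, hT, hκ, hΦT⟩ := exists_congruence hΦ (discriminant_pos hΦ hΨ hnt hint)
  have hcases := indefinite_or_nonneg hΨ hnt hT hκ hΦT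
  have hΨT : (Tᴴ * Ψ * T).IsHermitian := isHermitian_conjTranspose_mul_mul T hΨ
  set W' : Fin 2 → Matrix n r ℂ := fun k => ∑ i, T⁻¹ k i • W i with hW'
  have hW : (fun i => ∑ k, T i k • W' k) = W := by
    ext1 i
    simp only [hW', Finset.smul_sum, smul_smul]
    rw [Finset.sum_comm]
    simp only [← Finset.sum_smul]
    have : ∀ j, ∑ k, T i k * T⁻¹ k j = (1 : Matrix (Fin 2) (Fin 2) ℂ) i j := by
      intro j
      rw [← Matrix.mul_apply, mul_nonsing_inv T hT]
    simp only [this, Matrix.one_apply, ite_smul, one_smul, zero_smul, Finset.sum_ite_eq,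
      Finset.mem_univ, if_true]
  rw [← hW, pencil_congruence] at h0 h1
  rw [hΦT] at h0
  set Y := W' 0 with hY
  set Z := W' 1 with hZ
  -- The skew pencil is `κ i (Z Yᴴ - Y Zᴴ)`.
  have hYZ : Z * Yᴴ = Y * Zᴴ := by
    simp only [pencil, Fin.sum_univ_two, Matrix.smul_apply, of_apply, cons_val_zero, cons_val_one,
      cons_val', cons_val_fin_one, smul_eq_mul, mul_zero, zero_smul, zero_add, add_zero,
      mul_neg, neg_smul] at h0
    rw [← sub_eq_add_neg, ← smul_sub] at h0
    have hne : (κ : ℂ) * Complex.I ≠ 0 :=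
      mul_ne_zero (by exact_mod_cast hκ) Complex.I_ne_zero
    exact sub_eq_zero.1 ((smul_eq_zero.1 h0).resolve_left hne)
  have hR : (Y * Zᴴ).IsHermitian := by
    rw [IsHermitian, conjTranspose_mul, conjTranspose_conjTranspose, hYZ]
  -- Since `Z Yᴴ = Y Zᴴ`, the imaginary parts of the off-diagonal entries cancel and a real form
  -- remains.
  have hq : pencil (Tᴴ * Ψ * T) W' = (((Tᴴ * Ψ * T) 0 0).re : ℂ) • (Y * Yᴴ)
      + (2 * ((Tᴴ * Ψ * T) 0 1).re : ℂ) • (Y * Zᴴ)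
      + (((Tᴴ * Ψ * T) 1 1).re : ℂ) • (Z * Zᴴ) := by
    have e0 : (((Tᴴ * Ψ * T) 0 0).re : ℂ) = (Tᴴ * Ψ * T) 0 0 :=
      Complex.ext (by simp) (by simpa using (im_diag_eq_zero hΨT 0).symm)
    have e1 : (((Tᴴ * Ψ * T) 1 1).re : ℂ) = (Tᴴ * Ψ * T) 1 1 :=
      Complex.ext (by simp) (by simpa using (im_diag_eq_zero hΨT 1).symm)
    have e2 : (2 * ((Tᴴ * Ψ * T) 0 1).re : ℂ) = (Tᴴ * Ψ * T) 0 1 + (Tᴴ * Ψ * T) 1 0 := by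
      rw [← hΨT.apply 1 0]
      apply Complex.ext <;> simp
      ring
    rw [e0, e1, e2, pencil]
    simp only [Fin.sum_univ_two, ← hY, ← hZ, hYZ]
    module
  rw [hq] at h1
  obtain ⟨U, hU, V, a, b, hab, hpos, hYU, hZU⟩ := exists_unitary_of_quadratic hR hcases h1
  refine ⟨U, hU, V, fun j => T *ᵥ ![(a j : ℂ), (b j : ℂ)], fun j => ⟨?_, ?_, ?_⟩, fun i => ?_⟩
  · intro h
    have h' : ![(a j : ℂ), (b j : ℂ)] = 0 := by
      have := congrArg (fun x => T⁻¹ *ᵥ x) h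
      simpa only [mulVec_mulVec, nonsing_inv_mul T hT, one_mulVec, mulVec_zero] using this
    rcases hab j with hj | hj
    · exact hj (by simpa using congrFun h' 0)
    · exact hj (by simpa using congrFun h' 1)
  · rw [formValue_congruence, hΦT, formValue_skew]
    simp
  · rw [formValue_congruence, formValue_re hΨT]
    have := hpos j
    simp only [cons_val_zero, cons_val_one, Complex.ofReal_re, Complex.ofReal_im]
    rw [← Complex.ofReal_zero, Complex.real_le_real]
    linarith
  · rw [← hW]
    ext k j
    have hYkj := congrFun (congrFun hYU k) j
    have hZkj := congrFun (congrFun hZU k) j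
    simp only [mul_diagonal, Fin.sum_univ_two, ← hY, ← hZ, Matrix.add_mul, Matrix.smul_mul,
      Matrix.add_apply, Matrix.smul_apply, smul_eq_mul, mulVec, dotProduct, cons_val_zero,
      cons_val_one] at hYkj hZkj ⊢
    rw [hYkj, hZkj]
    ring

end RealForms

/-! ### Null spaces along the completed curve and pure tensors. -/

section Frequency

variable {n : ℕ} {ι : Type*} [Fintype ι]

/-- The two block rows of a matrix. -/
def blockRows (F : Matrix (Fin n ⊕ Fin n) ι ℂ) : Fin 2 → Matrix (Fin n) ι ℂ :=
  ![F.toRows₁, F.toRows₂]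

omit [Fintype ι] in
theorem conjTranspose_mul_kron_mul (F : Matrix (Fin n ⊕ Fin n) ι ℂ)
    (Φ : Matrix (Fin 2) (Fin 2) ℂ) (P : Matrix (Fin n) (Fin n) ℂ) :
    Fᴴ * kron Φ P * F = compression Φ P (blockRows F) := by
  conv_lhs => rw [kron_eq, ← fromRows_toRows F]
  rw [conjTranspose_fromRows_eq_fromCols_conjTranspose, fromCols_mul_fromBlocks,
    fromCols_mul_fromRows]
  simp only [compression, blockRows, Fin.sum_univ_two, cons_val_zero, cons_val_one,
    Matrix.add_mul, Matrix.mul_smul, Matrix.smul_mul]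
  abel

theorem gam_coe_mulVec (F : Matrix (Fin n ⊕ Fin n) ι ℂ) (lam : ℂ) (x : ι → ℂ) :
    (Gam n (lam : OnePoint ℂ) * F) *ᵥ x = blockRows F 0 *ᵥ x - lam • (blockRows F 1 *ᵥ x) := by
  have : Gam n (lam : OnePoint ℂ) = fromCols 1 (-(lam • 1)) := rfl
  conv_lhs => rw [this, ← fromRows_toRows F, fromCols_mul_fromRows]
  simp [blockRows, add_mulVec, neg_mulVec, smul_mulVec, sub_eq_add_neg]

theorem gam_infty_mulVec (F : Matrix (Fin n ⊕ Fin n) ι ℂ) (x : ι → ℂ) :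
    (Gam n OnePoint.infty * F) *ᵥ x = -(blockRows F 1 *ᵥ x) := by
  have : Gam n OnePoint.infty = fromCols 0 (-1) := rfl
  conv_lhs => rw [this, ← fromRows_toRows F, fromCols_mul_fromRows]
  simp [blockRows, neg_mulVec]

/-- On a pure tensor `v ⊗ w` the form of `Φ ⊗ P` splits into the product of the two forms. -/
theorem dotProduct_compression_mulVec (Φ : Matrix (Fin 2) (Fin 2) ℂ)
    (P : Matrix (Fin n) (Fin n) ℂ) (G : Fin 2 → Matrix (Fin n) ι ℂ) {x : ι → ℂ} {v : Fin 2 → ℂ}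
    {w : Fin n → ℂ} (h : ∀ i, G i *ᵥ x = v i • w) :
    star x ⬝ᵥ (compression Φ P G *ᵥ x) = formValue Φ v * (star w ⬝ᵥ (P *ᵥ w)) := by
  have key : ∀ i j, star x ⬝ᵥ (((G i)ᴴ * P * G j) *ᵥ x)
      = star (v i) * v j * (star w ⬝ᵥ (P *ᵥ w)) := by
    intro i j
    rw [Matrix.mul_assoc, ← mulVec_mulVec, dotProduct_mulVec, ← star_mulVec, h i,
      ← mulVec_mulVec, h j, mulVec_smul, star_smul, smul_dotProduct, dotProduct_smul,
      smul_eq_mul, smul_eq_mul, mul_assoc]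
  simp only [compression, Fin.sum_univ_two, add_mulVec, smul_mulVec, dotProduct_add,
    dotProduct_smul, key, smul_eq_mul]
  generalize star w ⬝ᵥ (P *ᵥ w) = c
  simp only [formValue, dotProduct, mulVec, Fin.sum_univ_two, Pi.star_apply]
  ring

/-- A vector in the null space for a frequency of the completed curve is mapped to a pure tensor
`v ⊗ w` in which `v` satisfies the two homogeneous conditions. -/
theorem exists_factor_of_mem_LamBar {Φ Ψ : Matrix (Fin 2) (Fin 2) ℂ} (hΦ : Φ.IsHermitian)
    (hΨ : Ψ.IsHermitian) (F : Matrix (Fin n ⊕ Fin n) ι ℂ) {z : OnePoint ℂ} (hz : z ∈ LamBar Φ Ψ)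
    {x : ι → ℂ} (hx : (Gam n z * F) *ᵥ x = 0) :
    ∃ (v : Fin 2 → ℂ) (w : Fin n → ℂ), formValue Φ v = 0 ∧ 0 ≤ formValue Ψ v ∧
      ∀ i, blockRows F i *ᵥ x = v i • w := by
  rcases hz with ⟨lam, hlam, rfl⟩ | ⟨rfl, hunb⟩
  · refine ⟨![lam, 1], blockRows F 1 *ᵥ x, hlam.1, hlam.2, fun i => ?_⟩
    rw [gam_coe_mulVec, sub_eq_zero] at hx
    fin_cases i
    · simpa using hx
    · simp
  · obtain ⟨h0, h1⟩ := leading_coeff_of_unbounded hΦ hΨ hunb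
    have e0 : Φ 0 0 = 0 := Complex.ext h0 (im_diag_eq_zero hΦ 0)
    have e1 : 0 ≤ Ψ 0 0 := Complex.le_def.2 ⟨h1, (im_diag_eq_zero hΨ 0).symm⟩
    refine ⟨![1, 0], blockRows F 0 *ᵥ x, ?_, ?_, fun i => ?_⟩
    · rw [formValue_infinite Φ (by simp), e0, mul_zero]
    · rw [formValue_infinite Ψ (by simp)]
      simpa using e1
    · rw [gam_infty_mulVec, neg_eq_zero] at hx
      fin_cases i
      · simp
      · simpa using hx

/-- Conversely, a vector mapped to such a pure tensor lies in the null space for some frequency. -/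
theorem exists_mem_LamBar_of_factor {Φ Ψ : Matrix (Fin 2) (Fin 2) ℂ} (hΦ : Φ.IsHermitian)
    (hΨ : Ψ.IsHermitian) (hnt : (Lam Φ Ψ).Nontrivial) (F : Matrix (Fin n ⊕ Fin n) ι ℂ)
    {x : ι → ℂ} {v : Fin 2 → ℂ} {w : Fin n → ℂ} (hv : v ≠ 0) (h0 : formValue Φ v = 0)
    (h1 : 0 ≤ formValue Ψ v) (hx : ∀ i, blockRows F i *ᵥ x = v i • w) :
    ∃ z ∈ LamBar Φ Ψ, (Gam n z * F) *ᵥ x = 0 := by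
  by_cases hv1 : v 1 = 0
  · have hv0 : v 0 ≠ 0 := by
      intro h
      apply hv
      ext i
      fin_cases i
      · exact h
      · exact hv1
    have hN : 0 < Complex.normSq (v 0) := Complex.normSq_pos.2 hv0
    rw [formValue_infinite _ hv1] at h0 h1
    refine ⟨OnePoint.infty, Or.inr ⟨rfl, unbounded_of_leading_coeff hΦ hΨ hnt ?_ ?_⟩, ?_⟩
    · have := congrArg Complex.re h0
      rw [Complex.re_ofReal_mul, Complex.zero_re] at this
      exact (mul_eq_zero.1 this).resolve_left hN.ne'
    · have := (Complex.le_def.1 h1).1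
      rw [Complex.re_ofReal_mul, Complex.zero_re] at this
      exact nonneg_of_mul_nonneg_right this hN
    · rw [gam_infty_mulVec, hx 1, hv1, zero_smul, neg_zero]
  · have hN : (0 : ℂ) < Complex.normSq (v 1) := by exact_mod_cast Complex.normSq_pos.2 hv1
    rw [formValue_affine _ hv1] at h0 h1
    refine ⟨((v 0 / v 1 : ℂ) : OnePoint ℂ), Or.inl ⟨_, ⟨?_, ?_⟩, rfl⟩, ?_⟩
    · exact (mul_eq_zero.1 h0).resolve_left hN.ne'
    · have := mul_nonneg (inv_nonneg.2 hN.le) h1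
      rwa [inv_mul_cancel_left₀ hN.ne'] at this
    · rw [gam_coe_mulVec, hx 0, hx 1, smul_smul, div_mul_cancel₀ _ hv1, sub_self]

theorem exists_isNullBasis {κ : Type*} (M : Matrix κ ι ℂ) :
    ∃ (k : ℕ) (S : Matrix ι (Fin k) ℂ), IsNullBasis M S := by
  let b := Module.finBasis ℂ (LinearMap.ker M.mulVecLin)
  refine ⟨_, of fun i j => (b j : ι → ℂ) i, ?_, ?_⟩
  · exact b.linearIndependent.map' (LinearMap.ker M.mulVecLin).subtype (Submodule.ker_subtype _)
  · have h := congrArg (Submodule.map (LinearMap.ker M.mulVecLin).subtype) b.span_eq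
    rw [Submodule.map_span, Submodule.map_subtype_top, ← Set.range_comp] at h
    exact h

theorem IsNullBasis.exists_mulVec_eq {κ τ : Type*} [Fintype τ] {M : Matrix κ ι ℂ}
    {S : Matrix ι τ ℂ} (hS : IsNullBasis M S) {x : ι → ℂ} (hx : M *ᵥ x = 0) :
    ∃ y, S *ᵥ y = x := by
  have : x ∈ LinearMap.ker M.mulVecLin := hx
  rw [← hS.2, ← range_mulVecLin] at this
  exact this

theorem IsNullBasis.mulVec_eq_zero {κ τ : Type*} [Fintype τ] {M : Matrix κ ι ℂ}
    {S : Matrix ι τ ℂ} (hS : IsNullBasis M S) (y : τ → ℂ) : M *ᵥ (S *ᵥ y) = 0 := by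
  have : S *ᵥ y ∈ LinearMap.range S.mulVecLin := ⟨y, rfl⟩
  rw [range_mulVecLin, hS.2] at this
  exact this

theorem IsNullBasis.mulVec_ne_zero {κ τ : Type*} [Fintype τ] {M : Matrix κ ι ℂ}
    {S : Matrix ι τ ℂ} (hS : IsNullBasis M S) {y : τ → ℂ} (hy : y ≠ 0) : S *ᵥ y ≠ 0 := by
  have := mulVec_injective_iff.2 hS.1
  intro h
  exact hy (this (by rw [h, mulVec_zero]))

theorem NegDef.dotProduct_mulVec_neg {X : Matrix ι ι ℂ} (hX : NegDef X) {x : ι → ℂ}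
    (hx : x ≠ 0) : star x ⬝ᵥ (X *ᵥ x) < 0 := by
  have := PosDef.dotProduct_mulVec_pos hX hx
  rw [neg_mulVec, dotProduct_neg] at this
  exact neg_pos.1 this

theorem dotProduct_conjTranspose_mul_mul {τ : Type*} [Fintype τ] (S : Matrix ι τ ℂ)
    (Θ : Matrix ι ι ℂ) (y : τ → ℂ) :
    star y ⬝ᵥ ((Sᴴ * Θ * S) *ᵥ y) = star (S *ᵥ y) ⬝ᵥ (Θ *ᵥ (S *ᵥ y)) := by
  rw [Matrix.mul_assoc, ← mulVec_mulVec, dotProduct_mulVec, ← star_mulVec, ← mulVec_mulVec]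

theorem trace_conjTranspose_mul_mul {τ : Type*} [Fintype τ] (X : Matrix ι τ ℂ)
    (Θ : Matrix ι ι ℂ) :
    (Xᴴ * Θ * X).trace = ∑ j, star (X.col j) ⬝ᵥ (Θ *ᵥ X.col j) := by
  rw [trace]
  refine Finset.sum_congr rfl fun j _ => ?_
  rw [diag_apply, Matrix.mul_assoc, Matrix.mul_apply]
  rfl

end Frequency

/-! ### From the frequency condition to the matrix inequality, and the equivalence. -/

/-- If `Θ` is negative on all null spaces along the completed curve, then the linear matrix
inequality is feasible. -/
theorem exists_of_forall_neg {n : ℕ} {ι : Type*} [Fintype ι] [DecidableEq ι]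
    {Φ Ψ : Matrix (Fin 2) (Fin 2) ℂ} (hΦ : Φ.IsHermitian) (hΨ : Ψ.IsHermitian)
    (hnt : (Lam Φ Ψ).Nontrivial) (hint : interior (Lam Φ Ψ) = ∅) {Θ : Matrix ι ι ℂ}
    (hΘ : Θ.IsHermitian) (F : Matrix (Fin n ⊕ Fin n) ι ℂ)
    (hneg : ∀ z ∈ LamBar Φ Ψ, ∀ x : ι → ℂ, (Gam n z * F) *ᵥ x = 0 → x ≠ 0 →
      star x ⬝ᵥ (Θ *ᵥ x) < 0) :
    ∃ P Q : Matrix (Fin n) (Fin n) ℂ, P.IsHermitian ∧ Q.PosDef ∧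
      NegDef (compression Φ P (blockRows F) + compression Ψ Q (blockRows F) + Θ) := by
  by_contra hinf
  obtain ⟨K, hK, h0, h1, htr⟩ := exists_dual_of_infeasible hΦ hΨ hΘ (blockRows F) hinf
  obtain ⟨U, hU, V, v, hv, hWU⟩ := exists_unitary_of_pencil hΦ hΨ hnt hint _ h0 h1
  have hUU : U * Uᴴ = 1 := mem_unitaryGroup_iff.1 hU
  have hcol : ∀ j i, blockRows F i *ᵥ (K * U).col j = v j i • V.col j := by
    intro j i
    ext k
    have h := congrFun (congrFun (hWU i) k) j
    rw [Matrix.mul_assoc, mul_diagonal] at h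
    rw [Pi.smul_apply, smul_eq_mul, mul_comm]
    exact h
  have hnonpos : ∀ j, (K * U).col j ≠ 0 →
      star ((K * U).col j) ⬝ᵥ (Θ *ᵥ (K * U).col j) < 0 := by
    intro j hj
    obtain ⟨z, hz, hzx⟩ :=
      exists_mem_LamBar_of_factor hΦ hΨ hnt F (hv j).1 (hv j).2.1 (hv j).2.2 (hcol j)
    exact hneg z hz _ hzx hj
  have hKU : ∃ j, (K * U).col j ≠ 0 := by
    by_contra! hc
    apply hK
    have : K * U = 0 := by
      ext i j
      exact congrFun (hc j) i
    calc K = K * U * Uᴴ := by rw [Matrix.mul_assoc, hUU, Matrix.mul_one]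
      _ = 0 := by rw [this, Matrix.zero_mul]
  obtain ⟨j₀, hj₀⟩ := hKU
  have hlt : ((K * U)ᴴ * Θ * (K * U)).trace < 0 := by
    rw [trace_conjTranspose_mul_mul]
    refine Finset.sum_neg' (fun j _ => ?_) ⟨j₀, Finset.mem_univ _, hnonpos j₀ hj₀⟩
    by_cases hj : (K * U).col j = 0
    · rw [hj]
      simp
    · exact (hnonpos j hj).le
  -- The unitary change of columns preserves the trace, so the negative column sum contradicts
  -- `htr`.
  have heq : ((K * U)ᴴ * Θ * (K * U)).trace = (Kᴴ * Θ * K).trace := by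
    rw [conjTranspose_mul, Matrix.mul_assoc, Matrix.mul_assoc, trace_mul_comm]
    have : Kᴴ * (Θ * (K * U)) * Uᴴ = Kᴴ * Θ * K * (U * Uᴴ) := by simp only [Matrix.mul_assoc]
    rw [this, hUU, Matrix.mul_one]
  rw [heq] at hlt
  exact absurd (Complex.lt_def.1 hlt).1 (not_lt.2 htr)

/-- An infinite curve supplies two distinct points, as the geometric lemmas require. -/
theorem RepresentsCurves.nontrivial {L : Set ℂ} (h : RepresentsCurves L) : L.Nontrivial := by
  obtain ⟨-, k, C, hk, hC, rfl⟩ := h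
  exact ((hC ⟨0, hk⟩).1.mono (Set.subset_iUnion C ⟨0, hk⟩)).nontrivial

end GKYP

theorem theorem3 (n m : ℕ)
    (A E : Matrix (Fin n) (Fin n) ℝ) (B : Matrix (Fin n) (Fin m) ℝ)
    (Θ : Matrix (Fin n ⊕ Fin m) (Fin n ⊕ Fin m) ℂ) (hΘ : Θ.IsHermitian)
    (Φ Ψ : Matrix (Fin 2) (Fin 2) ℂ) (hΦ : Φ.IsHermitian) (hΨ : Ψ.IsHermitian)
    (hcurves : GKYP.RepresentsCurves (GKYP.Lam Φ Ψ)) :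
    (∀ z ∈ GKYP.LamBar Φ Ψ, ∀ (k : ℕ) (S : Matrix (Fin n ⊕ Fin m) (Fin k) ℂ),
        GKYP.IsNullBasis (GKYP.Gam n z * GKYP.FMat A E B) S →
        GKYP.NegDef (Sᴴ * Θ * S)) ↔
      ∃ P Q : Matrix (Fin n) (Fin n) ℂ, P.IsHermitian ∧ Q.PosDef ∧
        GKYP.NegDef ((GKYP.FMat A E B)ᴴ * (GKYP.kron Φ P + GKYP.kron Ψ Q) * GKYP.FMat A E B
          + Θ) := by
  have hnt := hcurves.nontrivial
  set F := GKYP.FMat A E B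
  have hlmi : ∀ P Q : Matrix (Fin n) (Fin n) ℂ,
      Fᴴ * (GKYP.kron Φ P + GKYP.kron Ψ Q) * F
        = GKYP.compression Φ P (GKYP.blockRows F) + GKYP.compression Ψ Q (GKYP.blockRows F) := by
    intro P Q
    rw [Matrix.mul_add, Matrix.add_mul, GKYP.conjTranspose_mul_kron_mul,
      GKYP.conjTranspose_mul_kron_mul]
  simp only [hlmi]
  constructor
  · intro h
    refine GKYP.exists_of_forall_neg hΦ hΨ hnt hcurves.1 hΘ F fun z hz x hx hx0 => ?_
    obtain ⟨k, S, hS⟩ := GKYP.exists_isNullBasis (GKYP.Gam n z * F)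
    obtain ⟨y, rfl⟩ := hS.exists_mulVec_eq hx
    rw [← GKYP.dotProduct_conjTranspose_mul_mul]
    refine (h z hz k S hS).dotProduct_mulVec_neg ?_
    rintro rfl
    exact hx0 (Matrix.mulVec_zero S)
  · rintro ⟨P, Q, hP, hQ, hneg⟩ z hz k S hS
    have hherm : (Sᴴ * Θ * S).IsHermitian := Matrix.isHermitian_conjTranspose_mul_mul S hΘ
    refine Matrix.PosDef.of_dotProduct_mulVec_pos hherm.neg fun y hy => ?_
    rw [Matrix.neg_mulVec, dotProduct_neg, neg_pos, GKYP.dotProduct_conjTranspose_mul_mul]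
    obtain ⟨v, w, h0, h1, hvw⟩ :=
      GKYP.exists_factor_of_mem_LamBar hΦ hΨ F hz (hS.mulVec_eq_zero y)
    have hlt := hneg.dotProduct_mulVec_neg (hS.mulVec_ne_zero hy)
    -- The `Φ` term is zero and the `Ψ` term nonnegative, so the form of `Θ` lies below the negative
    -- total.
    rw [Matrix.add_mulVec, Matrix.add_mulVec, dotProduct_add, dotProduct_add,
      GKYP.dotProduct_compression_mulVec Φ P _ hvw, GKYP.dotProduct_compression_mulVec Ψ Q _ hvw,
      h0, zero_mul, zero_add] at hlt
    have hQw := mul_nonneg h1 (hQ.posSemidef.dotProduct_mulVec_nonneg w)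
    exact lt_of_le_of_lt (le_add_of_nonneg_left hQw) hlt
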